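/- Let $b,c_1,c_2$ be real numbers with $\tfrac14<b<\tfrac12+\tfrac{\sqrt3}{6}$. For every $\varepsilon>0$ the system $$\varepsilon^3x'=tx+y+\varepsilon^3c_1,\qquad \varepsilon^3y'=(t-b)x+ty+\varepsilon^3c_2$$ has exactly one solution $X_-=(x_-,y_-)$, defined on the whole real line $t\in\mathbb R$, such that $X_-(t)\to(0,0)$ as $t\to-\infty$. Its value at $t=b$ satisfies, as $\varepsilon\to0^+$ with $b,c_1,c_2$ fixed, $$x_-(b)=\left(-\frac1b c_1+\frac1{b^2}c_2\right)\varepsilon^3+\left(\left(\frac1{b^3}-\frac2{b^4}\right)c_1+\left(-\frac3{b^4}+\frac2{b^5}\right)c_2\right)\varepsilon^6+O(\varepsilon^9),$$ $$y_-(b)=-\frac1b c_2\,\varepsilon^3+\left(\frac1{b^3}c_1+\left(\frac1{b^3}-\frac1{b^4}\right)c_2\right)\varepsilon^6+O(\varepsilon^9).$$ -/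

import Mathlib

open Filter Topology Asymptotics

/-- `(x, y)` solves, on the whole real line, the slow-fast linear system
`ε³ x' = t x + y + ε³ c₁`, `ε³ y' = (t - b) x + t y + ε³ c₂`. -/
def IsModelSolution (b c₁ c₂ ε : ℝ) (x y : ℝ → ℝ) : Prop :=
  ∀ t : ℝ, ∃ x' y' : ℝ, HasDerivAt x x' t ∧ HasDerivAt y y' t ∧
    ε ^ 3 * x' = t * x t + y t + ε ^ 3 * c₁ ∧
    ε ^ 3 * y' = (t - b) * x t + t * y t + ε ^ 3 * c₂

/-- The curve `X = (x, y)` is a distinguished solution at `-∞`: it solves the system on the whole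
real line and tends to `(0, 0)` at `-∞`. -/
def IsDistinguishedMinus (b c₁ c₂ ε : ℝ) (X : ℝ → ℝ × ℝ) : Prop :=
  IsModelSolution b c₁ c₂ ε (fun t => (X t).1) (fun t => (X t).2) ∧
    Tendsto X atBot (𝓝 (0, 0))

/-! Put `η = ε³` and use the fast time `s = (t - b) / η`. The matrix of the system is `(b + η s)`
times the identity plus the companion matrix of the Airy equation `u'' = η s u`. Homogeneous
solutions are therefore `gaussWeight b η s`⁻¹ times Airy pairs `(u, v)`, `v = u'`. Pairing a
solution with an Airy pair gives d/ds [w (y u - x v)] = η w (c₂ u - c₁ v), w = `gaussWeight b η`.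
Airy functions grow more slowly than every Gaussian, so for a solution tending to 0 at `-∞` the
bracket vanishes there and equals `η` times the integral from `-∞` to `s`
(`IsFastSolution.representation`). Two Airy pairs of Wronskian 1 recover `x` and `y`: this gives
uniqueness and, read backwards, a candidate solution, whose decay follows from an energy estimate
(`IsFastSolution.tendsto_zero`).

At `t = b`, i.e. `s = 0`, the integral over `(-∞, 0]` is the integral over ℝ minus that over `(0,
∞)`. The former has a closed form, since Gaussian averaging maps an Airy function to a translate of
itself times an exponential: it is an explicit prefactor times `exp ((b²/2 - b/2 + 1/12) / η)` times
Airy values at `(1/4 - b) / η`. The upper bound on `b` makes the exponent negative, and `b > 1/4`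
puts the argument on the oscillatory side, where Airy functions grow only algebraically. This part
is thus negligible (`exists_abs_integral_gaussWeight_le`).

The integral over `(0, ∞)` is expanded by Laplace's method: Taylor in `η`, then integrate monomials
against `exp (-b s)` (`exists_abs_integral_Ioi_sub_le`). Its error `O(η²)`, times the prefactor `η`,
is `O(ε⁹)`. -/

open MeasureTheory Set

/-! ### Entire solutions of the scaled Airy equation -/

/-- The exponential generating series of a sequence of coefficients. -/
noncomputable def expSeries (a : ℕ → ℝ) (z : ℝ) : ℝ :=
  ∑' k : ℕ, a k / k.factorial * z ^ k

theorem summable_expSeries {a : ℕ → ℝ} (ha : ∀ k, |a k| ≤ 1) (z : ℝ) :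
    Summable fun k : ℕ => a k / k.factorial * z ^ k := by
  refine Summable.of_norm_bounded (Real.summable_pow_div_factorial |z|) fun k => ?_
  rw [norm_mul, norm_div, norm_pow, Real.norm_natCast, Real.norm_eq_abs, Real.norm_eq_abs,
    div_mul_eq_mul_div]
  gcongr
  exact mul_le_of_le_one_left (by positivity) (ha k)

theorem natCast_div_factorial (k : ℕ) : ((k + 1 : ℕ) : ℝ) / (k + 1).factorial
    = 1 / k.factorial := by
  rw [Nat.factorial_succ]
  have : (k.factorial : ℝ) ≠ 0 := by positivity
  have : ((k + 1 : ℕ) : ℝ) ≠ 0 := by positivity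
  push_cast at *
  field_simp

theorem hasDerivAt_expSeries {a : ℕ → ℝ} (ha : ∀ k, |a k| ≤ 1) (z : ℝ) :
    HasDerivAt (expSeries a) (expSeries (fun k => a (k + 1)) z) z := by
  have hsum : Summable fun n : ℕ => ((n : ℝ) / n.factorial) * (|z| + 1) ^ (n - 1) := by
    rw [← summable_nat_add_iff 1]
    refine (Real.summable_pow_div_factorial (|z| + 1)).congr fun k => ?_
    rw [natCast_div_factorial, Nat.add_sub_cancel]
    ring
  have hz : z ∈ Metric.ball (0 : ℝ) (|z| + 1) := by simp
  have key := hasDerivAt_tsum_of_isPreconnected (g := fun (n : ℕ) y => a n / n.factorial * y ^ n)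
    (g' := fun (n : ℕ) y => a n / n.factorial * (n * y ^ (n - 1))) (y₀ := 0) (y := z)
    hsum Metric.isOpen_ball (convex_ball (0 : ℝ) (|z| + 1)).isPreconnected
    (fun n y _ => (hasDerivAt_pow n y).const_mul _) (fun n y hy => ?_)
    (by simp; positivity) (summable_expSeries ha 0) hz
  · refine key.congr_deriv ?_
    have h' : Summable fun n : ℕ => a n / n.factorial * (n * z ^ (n - 1)) := by
      rw [← summable_nat_add_iff 1]
      refine (summable_expSeries (a := fun k => a (k + 1)) (fun k => ha _) z).congr fun k => ?_
      have := natCast_div_factorial k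
      rw [Nat.add_sub_cancel, div_eq_mul_one_div (a (k + 1)) k.factorial, ← this]
      ring
    rw [h'.tsum_eq_zero_add]
    simp only [Nat.cast_zero, zero_mul, mul_zero, zero_add, expSeries]
    refine tsum_congr fun k => ?_
    have := natCast_div_factorial k
    rw [Nat.add_sub_cancel, div_eq_mul_one_div (a (k + 1)) k.factorial, ← this]
    ring
  · have hy' : |y| ≤ |z| + 1 := by simpa using (Metric.mem_ball.1 hy).le
    rw [norm_mul, norm_div, norm_mul, norm_pow, Real.norm_eq_abs, Real.norm_natCast,
      Real.norm_natCast, Real.norm_eq_abs]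
    calc |a n| / n.factorial * (n * |y| ^ (n - 1))
        ≤ 1 / n.factorial * (n * (|z| + 1) ^ (n - 1)) := by
          gcongr
          exact ha n
      _ = _ := by ring

/-- Multiplication by `z` shifts the index: `z ∑ a (k + 2) z^k / k! = ∑ k a (k + 1) z^k / k!`. The
differential equation is thus the recurrence, coefficient by coefficient. -/
theorem expSeries_recurrence {a : ℕ → ℝ} (ha : ∀ k, |a k| ≤ 1) {m : ℝ}
    (hrec : ∀ k : ℕ, (m + 9 * k) * a (k + 1) = a k) (z : ℝ) :
    m * expSeries (fun k => a (k + 1)) z + 9 * z * expSeries (fun k => a (k + 2)) z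
      = expSeries a z := by
  have h1 := summable_expSeries (a := fun k => a (k + 1)) (fun k => ha _) z
  have h2 := summable_expSeries (a := fun k => a (k + 2)) (fun k => ha _) z
  have hterm : ∀ k : ℕ, (((k + 1 : ℕ) : ℝ) * (a (k + 1 + 1) / (k + 1).factorial * z ^ (k + 1)))
      = z * (a (k + 2) / k.factorial * z ^ k) := fun k => by
    have := natCast_div_factorial k
    rw [div_eq_mul_one_div (a (k + 2)) k.factorial, ← this]
    ring
  have h3 : Summable fun k : ℕ => (k : ℝ) * (a (k + 1) / k.factorial * z ^ k) := by
    rw [← summable_nat_add_iff 1]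
    exact (h2.mul_left z).congr fun k => (hterm k).symm
  have h4 : z * expSeries (fun k => a (k + 2)) z
      = ∑' k : ℕ, (k : ℝ) * (a (k + 1) / k.factorial * z ^ k) := by
    rw [h3.tsum_eq_zero_add, expSeries, ← tsum_mul_left]
    simp only [Nat.cast_zero, zero_mul, zero_add]
    exact tsum_congr fun k => (hterm k).symm
  rw [mul_assoc 9, h4, expSeries, expSeries, ← tsum_mul_left, ← tsum_mul_left,
    ← (h1.mul_left m).tsum_add (h3.mul_left 9)]
  refine tsum_congr fun k => ?_
  rw [← hrec k]
  ring

theorem exists_expSeries_ode {m : ℝ} (hm : 1 ≤ m) :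
    ∃ F F' F'' : ℝ → ℝ, (∀ z, HasDerivAt F (F' z) z) ∧ (∀ z, HasDerivAt F' (F'' z) z) ∧
      (∀ z, m * F' z + 9 * z * F'' z = F z) ∧ F 0 = 1 := by
  set a : ℕ → ℝ := fun k => ∏ j ∈ Finset.range k, (m + 9 * j)⁻¹ with ha_def
  have hpos : ∀ j : ℕ, 1 ≤ m + 9 * j := fun j => by
    have : (0 : ℝ) ≤ j := j.cast_nonneg
    linarith
  have ha : ∀ k, |a k| ≤ 1 := fun k => by
    rw [ha_def, Finset.abs_prod]
    refine Finset.prod_le_one (fun _ _ => abs_nonneg _) fun j _ => ?_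
    have := hpos j
    rw [abs_of_nonneg (by positivity)]
    exact inv_le_one_of_one_le₀ this
  refine ⟨expSeries a, expSeries (fun k => a (k + 1)), expSeries (fun k => a (k + 2)),
    hasDerivAt_expSeries ha, hasDerivAt_expSeries (fun k => ha _),
    expSeries_recurrence ha fun k => ?_, ?_⟩
  · have := hpos k
    simp only [ha_def, Finset.prod_range_succ]
    field_simp
  · rw [expSeries, tsum_eq_single 0 fun k hk => by simp [hk]]
    simp [ha_def]

/-- `u` solves the scaled Airy equation `u'' = η σ u`, with derivative `v`. -/
structure IsAiryPair (η : ℝ) (u v : ℝ → ℝ) : Prop where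
  deriv_fst : ∀ s, HasDerivAt u (v s) s
  deriv_snd : ∀ s, HasDerivAt v (η * s * u s) s

theorem exists_isAiryPair (η a d : ℝ) :
    ∃ u v : ℝ → ℝ, IsAiryPair η u v ∧ u 0 = a ∧ v 0 = d := by
  -- With `z = η s³`, the ansatz `u = F z` turns `u'' = η s u` into the series equation with `m =
  -- 6`; the ansatz `u = s * G z` gives `m = 12`.
  obtain ⟨F, F', F'', hF, hF', hFe, hF0⟩ := exists_expSeries_ode (m := 6) (by norm_num)
  obtain ⟨G, G', G'', hG, hG', hGe, hG0⟩ := exists_expSeries_ode (m := 12) (by norm_num)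
  have hz : ∀ s : ℝ, HasDerivAt (fun s => η * s ^ 3) (η * (3 * s ^ 2)) s := fun s => by
    simpa using (hasDerivAt_pow 3 s).const_mul η
  have c : ∀ {H H' : ℝ → ℝ}, (∀ z, HasDerivAt H (H' z) z) → ∀ s,
      HasDerivAt (fun s => H (η * s ^ 3)) (H' (η * s ^ 3) * (η * (3 * s ^ 2))) s :=
    fun hH s => (hH _).comp s (hz s)
  refine ⟨fun s => a * F (η * s ^ 3) + d * (s * G (η * s ^ 3)),
    fun s => a * (F' (η * s ^ 3) * (η * (3 * s ^ 2))) +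
      d * (G (η * s ^ 3) + 3 * ((η * s ^ 3) * G' (η * s ^ 3))), ⟨fun s => ?_, fun s => ?_⟩, ?_, ?_⟩
  · refine (((c hF s).const_mul a).add
      (((hasDerivAt_id s).mul (c hG s)).const_mul d)).congr_deriv ?_
    simp only [id]
    ring
  · have h2 : HasDerivAt (fun s : ℝ => η * (3 * s ^ 2)) (η * (6 * s)) s := by
      refine (((hasDerivAt_pow 2 s).const_mul 3).const_mul η).congr_deriv ?_
      rw [show (2 : ℕ) - 1 = 1 from rfl]
      push_cast
      ring
    refine ((((c hF' s).mul h2).const_mul a).add (((c hG s).add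
      (((hz s).mul (c hG' s)).const_mul 3)).const_mul d)).congr_deriv ?_
    rw [← hFe, ← hGe]
    ring
  · simp [hF0]
  · simp [hG0]

/-! ### Growth of Airy pairs -/

/-- The energy has derivative `2 (k² + η s) u v`, and `2 k |u v|` is at most the energy, so Grönwall
applies. The free parameter `k` trades Gaussian growth for exponential growth: a large `k` makes the
Gaussian rate as small as desired. -/
theorem IsAiryPair.energy_le_of_nonneg {η : ℝ} {u v : ℝ → ℝ} (h : IsAiryPair η u v) {k : ℝ}
    (hk : 0 < k) {s : ℝ} (hs : 0 ≤ s) :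
    k ^ 2 * u s ^ 2 + v s ^ 2 ≤
      (k ^ 2 * u 0 ^ 2 + v 0 ^ 2) * Real.exp (k * s + |η| * s ^ 2 / (2 * k)) := by
  have hd : ∀ s, HasDerivAt
      (fun s => (k ^ 2 * u s ^ 2 + v s ^ 2) * Real.exp (-(k * s + |η| * s ^ 2 / (2 * k))))
      ((2 * (k ^ 2 + η * s) * (u s * v s) - (k + |η| * s / k) * (k ^ 2 * u s ^ 2 + v s ^ 2)) *
        Real.exp (-(k * s + |η| * s ^ 2 / (2 * k)))) s := fun s => by
    have h1 : HasDerivAt (fun s : ℝ => -(k * s + |η| * s ^ 2 / (2 * k)))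
        (-(k + |η| * s / k)) s := by
      refine (((hasDerivAt_id s).const_mul k).add
        (((hasDerivAt_pow 2 s).const_mul |η|).div_const (2 * k))).neg.congr_deriv ?_
      rw [show (2 : ℕ) - 1 = 1 from rfl]
      field_simp
      push_cast
      ring
    refine ((((h.deriv_fst s).pow 2).const_mul (k ^ 2)).add ((h.deriv_snd s).pow 2)
      |>.mul h1.exp).congr_deriv ?_
    rw [show (2 : ℕ) - 1 = 1 from rfl]
    simp only [Pi.add_apply, Pi.pow_apply]
    push_cast
    ring
  have hanti : AntitoneOn
      (fun s => (k ^ 2 * u s ^ 2 + v s ^ 2) * Real.exp (-(k * s + |η| * s ^ 2 / (2 * k))))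
      (Ici 0) := by
    refine antitoneOn_of_hasDerivWithinAt_nonpos (convex_Ici 0)
      (fun x _ => (hd x).continuousAt.continuousWithinAt)
      (fun x _ => (hd x).hasDerivWithinAt) fun x hx => ?_
    have hx : 0 < x := by simpa using hx
    refine mul_nonpos_of_nonpos_of_nonneg ?_ (Real.exp_pos _).le
    have e : (k + |η| * x / k) * (k ^ 2 * u x ^ 2 + v x ^ 2) =
        (k ^ 2 + |η| * x) * ((k ^ 2 * u x ^ 2 + v x ^ 2) / k) := by
      field_simp
    have h1 : 2 * |u x * v x| ≤ (k ^ 2 * u x ^ 2 + v x ^ 2) / k := by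
      rw [le_div_iff₀ hk, abs_mul]
      nlinarith [sq_nonneg (k * |u x| - |v x|), sq_abs (u x), sq_abs (v x)]
    have h2 : (k ^ 2 + η * x) * (u x * v x) ≤ (k ^ 2 + |η| * x) * |u x * v x| := by
      refine (le_abs_self _).trans ?_
      rw [abs_mul]
      gcongr
      refine (abs_add_le _ _).trans ?_
      rw [abs_mul η, abs_of_pos hx, abs_of_nonneg (sq_nonneg k)]
    have h3 := mul_le_mul_of_nonneg_left h1 (show 0 ≤ k ^ 2 + |η| * x by positivity)
    rw [e]
    linarith
  have h0 := hanti (mem_Ici.2 le_rfl) (mem_Ici.2 hs) hs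
  simp only [mul_zero, ne_eq, OfNat.ofNat_ne_zero, not_false_eq_true, zero_pow, zero_div, add_zero,
    neg_zero, Real.exp_zero, mul_one] at h0
  rwa [Real.exp_neg, ← div_eq_mul_inv, div_le_iff₀ (Real.exp_pos _)] at h0

theorem IsAiryPair.reflect {η : ℝ} {u v : ℝ → ℝ} (h : IsAiryPair η u v) :
    IsAiryPair (-η) (fun s => u (-s)) (fun s => -v (-s)) where
  deriv_fst s := ((h.deriv_fst (-s)).comp s (hasDerivAt_neg s)).congr_deriv (by ring)
  deriv_snd s := ((h.deriv_snd (-s)).comp s (hasDerivAt_neg s)).neg.congr_deriv (by ring)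

theorem IsAiryPair.energy_le {η : ℝ} {u v : ℝ → ℝ} (h : IsAiryPair η u v) {k : ℝ}
    (hk : 0 < k) (s : ℝ) :
    k ^ 2 * u s ^ 2 + v s ^ 2 ≤
      (k ^ 2 * u 0 ^ 2 + v 0 ^ 2) * Real.exp (k * |s| + |η| * s ^ 2 / (2 * k)) := by
  rcases le_total 0 s with hs | hs
  · rw [abs_of_nonneg hs]
    exact h.energy_le_of_nonneg hk hs
  · have := h.reflect.energy_le_of_nonneg hk (neg_nonneg.2 hs)
    rw [abs_of_nonpos hs]
    simpa using this

/-! ### Functions of subgaussian growth -/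

/-- Continuous functions growing more slowly than every Gaussian. -/
structure SubgaussianGrowth (q : ℝ → ℝ) : Prop where
  continuous : Continuous q
  bound : ∀ δ : ℝ, 0 < δ → ∃ C, 0 ≤ C ∧ ∀ s, |q s| ≤ C * Real.exp (δ * s ^ 2)

theorem SubgaussianGrowth.of_sq_le {q : ℝ → ℝ} (hq : Continuous q)
    (h : ∀ δ : ℝ, 0 < δ → ∃ C, 0 ≤ C ∧ ∀ s, q s ^ 2 ≤ C * Real.exp (δ * s ^ 2)) :
    SubgaussianGrowth q := by
  refine ⟨hq, fun δ hδ => ?_⟩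
  obtain ⟨C, hC, hb⟩ := h (2 * δ) (by positivity)
  refine ⟨√C, Real.sqrt_nonneg C, fun s => abs_le_of_sq_le_sq ?_ (by positivity)⟩
  rw [mul_pow, Real.sq_sqrt hC, ← Real.exp_nat_mul]
  refine (hb s).trans_eq ?_
  congr 2
  push_cast
  ring

theorem SubgaussianGrowth.const_mul {q : ℝ → ℝ} (h : SubgaussianGrowth q) (c : ℝ) :
    SubgaussianGrowth fun s => c * q s := by
  refine ⟨continuous_const.mul h.continuous, fun δ hδ => ?_⟩
  obtain ⟨C, hC, hb⟩ := h.bound δ hδ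
  refine ⟨|c| * C, by positivity, fun s => ?_⟩
  rw [abs_mul, mul_assoc]
  gcongr
  exact hb s

theorem SubgaussianGrowth.add {q r : ℝ → ℝ} (h : SubgaussianGrowth q) (h' : SubgaussianGrowth r) :
    SubgaussianGrowth fun s => q s + r s := by
  refine ⟨h.continuous.add h'.continuous, fun δ hδ => ?_⟩
  obtain ⟨C, hC, hb⟩ := h.bound δ hδ
  obtain ⟨C', hC', hb'⟩ := h'.bound δ hδ
  refine ⟨C + C', by positivity, fun s => ?_⟩
  rw [add_mul]
  exact (abs_add_le _ _).trans (add_le_add (hb s) (hb' s))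

theorem SubgaussianGrowth.sub {q r : ℝ → ℝ} (h : SubgaussianGrowth q) (h' : SubgaussianGrowth r) :
    SubgaussianGrowth fun s => q s - r s := by
  simpa [sub_eq_add_neg] using h.add (h'.const_mul (-1))

theorem abs_le_mul_exp_mul_sq {δ : ℝ} (hδ : 0 < δ) (s : ℝ) :
    |s| ≤ (1 + 1 / δ) * Real.exp (δ * s ^ 2) := by
  have h1 := Real.add_one_le_exp (δ * s ^ 2)
  have h2 : |s| ≤ 1 + s ^ 2 := by nlinarith [sq_nonneg (|s| - 1), sq_abs s]
  have h3 : (1 + 1 / δ) * (δ * s ^ 2 + 1) = δ * s ^ 2 + 1 + s ^ 2 + 1 / δ := by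
    field_simp
    ring
  have h4 := mul_le_mul_of_nonneg_left h1 (show 0 ≤ 1 + 1 / δ by positivity)
  have h5 : 0 ≤ δ * s ^ 2 + 1 / δ := by positivity
  linarith

theorem SubgaussianGrowth.id_mul {q : ℝ → ℝ} (h : SubgaussianGrowth q) :
    SubgaussianGrowth fun s => s * q s := by
  refine ⟨continuous_id.mul h.continuous, fun δ hδ => ?_⟩
  obtain ⟨C, hC, hb⟩ := h.bound (δ / 2) (by positivity)
  refine ⟨(1 + 1 / (δ / 2)) * C, by positivity, fun s => ?_⟩
  have e : Real.exp (δ * s ^ 2) = Real.exp (δ / 2 * s ^ 2) * Real.exp (δ / 2 * s ^ 2) := by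
    rw [← Real.exp_add]
    ring_nf
  rw [abs_mul, e, mul_mul_mul_comm]
  exact mul_le_mul (abs_le_mul_exp_mul_sq (by positivity) s) (hb s) (abs_nonneg _) (by positivity)

theorem IsAiryPair.exists_energy_le {η : ℝ} {u v : ℝ → ℝ} (h : IsAiryPair η u v)
    {δ : ℝ} (hδ : 0 < δ) :
    ∃ C, 0 ≤ C ∧ ∀ s, u s ^ 2 + v s ^ 2 ≤ C * Real.exp (δ * s ^ 2) := by
  -- The first summand brings the Gaussian rate below `δ / 2`; the `+ 1` ensures `u² ≤ k² u²`. The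
  -- linear term `k |s|` costs the other `δ / 2`.
  set k : ℝ := |η| / δ + 1 with hk
  have hk1 : 1 ≤ k := by rw [hk]; linarith [show 0 ≤ |η| / δ by positivity]
  have hk0 : 0 < k := by linarith
  refine ⟨(k ^ 2 * u 0 ^ 2 + v 0 ^ 2) * Real.exp (k ^ 2 / (2 * δ)), by positivity, fun s => ?_⟩
  have h1 := h.energy_le hk0 s
  have h2 : u s ^ 2 ≤ k ^ 2 * u s ^ 2 := le_mul_of_one_le_left (sq_nonneg _) (one_le_pow₀ hk1)
  have h3 : k * |s| + |η| * s ^ 2 / (2 * k) ≤ k ^ 2 / (2 * δ) + δ * s ^ 2 := by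
    have h4 : |η| * s ^ 2 / (2 * k) ≤ δ / 2 * s ^ 2 := by
      rw [div_le_iff₀ (by positivity)]
      have : |η| ≤ δ * k := by
        rw [hk, mul_add, mul_div_cancel₀ _ hδ.ne']
        linarith
      nlinarith [sq_nonneg s]
    have h5 : k * |s| ≤ k ^ 2 / (2 * δ) + δ / 2 * s ^ 2 := by
      rw [div_add' _ _ _ (by positivity), le_div_iff₀ (by positivity), ← sq_abs s]
      nlinarith [sq_nonneg (k - δ * |s|)]
    linarith
  calc u s ^ 2 + v s ^ 2 ≤ k ^ 2 * u s ^ 2 + v s ^ 2 := by linarith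
    _ ≤ _ := h1
    _ ≤ _ := by
      rw [mul_assoc, ← Real.exp_add]
      gcongr

theorem IsAiryPair.subgaussian_fst {η : ℝ} {u v : ℝ → ℝ} (h : IsAiryPair η u v) :
    SubgaussianGrowth u :=
  .of_sq_le (continuous_iff_continuousAt.2 fun s => (h.deriv_fst s).continuousAt) fun δ hδ => by
    obtain ⟨C, hC, hb⟩ := h.exists_energy_le hδ
    exact ⟨C, hC, fun s => by nlinarith [hb s, sq_nonneg (v s)]⟩

theorem IsAiryPair.subgaussian_snd {η : ℝ} {u v : ℝ → ℝ} (h : IsAiryPair η u v) :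
    SubgaussianGrowth v :=
  .of_sq_le (continuous_iff_continuousAt.2 fun s => (h.deriv_snd s).continuousAt) fun δ hδ => by
    obtain ⟨C, hC, hb⟩ := h.exists_energy_le hδ
    exact ⟨C, hC, fun s => by nlinarith [hb s, sq_nonneg (u s)]⟩

/-! ### Gaussian weight and forcing integrals -/

/-- The Gaussian weight `exp (-b s - η s² / 2)`. -/
noncomputable def gaussWeight (b η s : ℝ) : ℝ := Real.exp (-(b * s) - η * s ^ 2 / 2)

theorem gaussWeight_pos (b η s : ℝ) : 0 < gaussWeight b η s := Real.exp_pos _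

theorem continuous_gaussWeight (b η : ℝ) : Continuous (gaussWeight b η) := by
  unfold gaussWeight
  fun_prop

theorem hasDerivAt_gaussWeight (b η s : ℝ) :
    HasDerivAt (gaussWeight b η) (-(b + η * s) * gaussWeight b η s) s := by
  have h : HasDerivAt (fun s : ℝ => -(b * s) - η * s ^ 2 / 2) (-(b + η * s)) s := by
    refine (((hasDerivAt_id s).const_mul b).neg.sub
      (((hasDerivAt_pow 2 s).const_mul η).div_const 2)).congr_deriv ?_
    rw [show (2 : ℕ) - 1 = 1 from rfl]
    push_cast
    ring
  exact h.exp.congr_deriv (mul_comm _ _)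

theorem SubgaussianGrowth.exists_abs_gaussWeight_mul_le {q : ℝ → ℝ} (h : SubgaussianGrowth q)
    (b : ℝ) {η δ : ℝ} (hδ : 0 < δ) :
    ∃ C, 0 ≤ C ∧ ∀ s, |gaussWeight b η s * q s| ≤ C * Real.exp (-(η / 2 - δ) * s ^ 2) := by
  obtain ⟨C, hC, hb⟩ := h.bound (δ / 2) (by positivity)
  refine ⟨C * Real.exp (b ^ 2 / (2 * δ)), by positivity, fun s => ?_⟩
  have h1 : -(b * s) ≤ b ^ 2 / (2 * δ) + δ / 2 * s ^ 2 := by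
    rw [div_add' _ _ _ (by positivity), le_div_iff₀ (by positivity)]
    nlinarith [sq_nonneg (b + δ * s)]
  rw [abs_mul, abs_of_pos (gaussWeight_pos _ _ _), gaussWeight]
  calc _ ≤ Real.exp (-(b * s) - η * s ^ 2 / 2) * (C * Real.exp (δ / 2 * s ^ 2)) := by
        gcongr
        exact hb s
    _ = C * Real.exp (-(b * s) - η * s ^ 2 / 2 + δ / 2 * s ^ 2) := by
        rw [Real.exp_add]
        ring
    _ ≤ C * Real.exp (b ^ 2 / (2 * δ) + -(η / 2 - δ) * s ^ 2) :=
        mul_le_mul_of_nonneg_left (Real.exp_le_exp.2 (by linarith)) hC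
    _ = _ := by rw [Real.exp_add, mul_assoc]

theorem SubgaussianGrowth.integrable {q : ℝ → ℝ} (h : SubgaussianGrowth q) (b : ℝ) {η : ℝ}
    (hη : 0 < η) : Integrable fun s => gaussWeight b η s * q s := by
  obtain ⟨C, -, hb⟩ := h.exists_abs_gaussWeight_mul_le b (η := η) (δ := η / 4) (by positivity)
  refine ((integrable_exp_neg_mul_sq (b := η / 2 - η / 4) (by linarith)).const_mul C).mono'
    ((continuous_gaussWeight b η).mul h.continuous).aestronglyMeasurable (ae_of_all _ hb)

theorem SubgaussianGrowth.tendsto_zero {q : ℝ → ℝ} (h : SubgaussianGrowth q) (b : ℝ) {η : ℝ}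
    (hη : 0 < η) {l : Filter ℝ} (hl : Tendsto (fun s : ℝ => s ^ 2) l atTop) :
    Tendsto (fun s => gaussWeight b η s * q s) l (𝓝 0) := by
  obtain ⟨C, -, hb⟩ := h.exists_abs_gaussWeight_mul_le b (η := η) (δ := η / 4) (by positivity)
  refine squeeze_zero_norm hb ?_
  have : Tendsto (fun s : ℝ => -(η / 2 - η / 4) * s ^ 2) l atBot :=
    hl.const_mul_atTop_of_neg (by linarith)
  simpa using (Real.tendsto_exp_atBot.comp this).const_mul C

theorem SubgaussianGrowth.mul {q r : ℝ → ℝ} (h : SubgaussianGrowth q) (h' : SubgaussianGrowth r) :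
    SubgaussianGrowth fun s => q s * r s := by
  refine ⟨h.continuous.mul h'.continuous, fun δ hδ => ?_⟩
  obtain ⟨C, hC, hb⟩ := h.bound (δ / 2) (by positivity)
  obtain ⟨C', hC', hb'⟩ := h'.bound (δ / 2) (by positivity)
  refine ⟨C * C', by positivity, fun s => ?_⟩
  have e : Real.exp (δ * s ^ 2) = Real.exp (δ / 2 * s ^ 2) * Real.exp (δ / 2 * s ^ 2) := by
    rw [← Real.exp_add]
    congr 1
    ring
  rw [abs_mul, e, mul_mul_mul_comm]
  exact mul_le_mul (hb s) (hb' s) (abs_nonneg _) (by positivity)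

/-- The integral of a forcing term against the Gaussian weight, from `-∞`. -/
noncomputable def forcingIntegral (b η : ℝ) (q : ℝ → ℝ) (s : ℝ) : ℝ :=
  ∫ r in Iic s, gaussWeight b η r * q r

theorem SubgaussianGrowth.hasDerivAt_forcingIntegral {q : ℝ → ℝ} (h : SubgaussianGrowth q) (b : ℝ)
    {η : ℝ} (hη : 0 < η) (s : ℝ) :
    HasDerivAt (forcingIntegral b η q) (gaussWeight b η s * q s) s := by
  have hi := h.integrable b hη
  have hc : Continuous fun r => gaussWeight b η r * q r :=
    (continuous_gaussWeight b η).mul h.continuous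
  have e : forcingIntegral b η q =
      fun s => (∫ r in (0 : ℝ)..s, gaussWeight b η r * q r) + forcingIntegral b η q 0 := by
    funext s
    rw [← intervalIntegral.integral_Iic_sub_Iic hi.integrableOn hi.integrableOn]
    simp [forcingIntegral]
  rw [e]
  exact (intervalIntegral.integral_hasDerivAt_right (hc.intervalIntegrable _ _)
    hc.aestronglyMeasurable.stronglyMeasurableAtFilter hc.continuousAt).add_const _

/-- The left tail of the weighted integral has size `exp (-η s² / 2)` up to subgaussian factors.
Evaluating at `-|s|` makes the bound two-sided, so that the algebra of `SubgaussianGrowth` applies;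
it is used only for `s ≤ 0`. -/
theorem SubgaussianGrowth.forcingIntegral_neg_abs {q : ℝ → ℝ} (h : SubgaussianGrowth q) (b : ℝ)
    {η : ℝ} (hη : 0 < η) :
    SubgaussianGrowth fun s => Real.exp (η * s ^ 2 / 2) * forcingIntegral b η q (-|s|) := by
  have hcont : Continuous (forcingIntegral b η q) :=
    continuous_iff_continuousAt.2 fun s => (h.hasDerivAt_forcingIntegral b hη s).continuousAt
  refine ⟨by fun_prop, fun δ hδ => ?_⟩
  -- Keeps the rate `η / 2 - δ` nonnegative, so that `r² ≥ s²` on the tail can be used.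
  wlog hδη : δ ≤ η / 2 generalizing δ
  · obtain ⟨C, hC, hb⟩ := this (η / 2) (by positivity) le_rfl
    refine ⟨C, hC, fun s => (hb s).trans ?_⟩
    gcongr
    exact (not_le.1 hδη).le
  obtain ⟨C, hC, hb⟩ := h.exists_abs_gaussWeight_mul_le b (η := η) (δ := δ / 2) (by positivity)
  have hg : Integrable fun r : ℝ => Real.exp (-(δ / 2) * r ^ 2) :=
    integrable_exp_neg_mul_sq (by positivity)
  refine ⟨C * ∫ r : ℝ, Real.exp (-(δ / 2) * r ^ 2),
    mul_nonneg hC (integral_nonneg fun r => (Real.exp_pos _).le), fun s => ?_⟩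
  have hN : |forcingIntegral b η q (-|s|)| ≤
      C * Real.exp (-(η / 2 - δ) * s ^ 2) * ∫ r : ℝ, Real.exp (-(δ / 2) * r ^ 2) := by
    calc |forcingIntegral b η q (-|s|)|
        ≤ ∫ r in Iic (-|s|), |gaussWeight b η r * q r| := by
          simpa only [Real.norm_eq_abs, forcingIntegral] using
            norm_integral_le_integral_norm (μ := volume.restrict (Iic (-|s|)))
              (fun r => gaussWeight b η r * q r)
      _ ≤ ∫ r in Iic (-|s|),
            C * Real.exp (-(η / 2 - δ) * s ^ 2) * Real.exp (-(δ / 2) * r ^ 2) := by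
          refine setIntegral_mono_on (h.integrable b hη).abs.integrableOn
            (hg.const_mul _).integrableOn measurableSet_Iic fun r hr => (hb r).trans ?_
          rw [mul_assoc, ← Real.exp_add]
          have : s ^ 2 ≤ r ^ 2 := by
            rw [← sq_abs s]
            have hr' : r ≤ -|s| := hr
            nlinarith [abs_nonneg s]
          have := mul_le_mul_of_nonneg_left this (sub_nonneg.2 hδη)
          exact mul_le_mul_of_nonneg_left (Real.exp_le_exp.2 (by linarith)) hC
      _ = C * Real.exp (-(η / 2 - δ) * s ^ 2) *
            ∫ r in Iic (-|s|), Real.exp (-(δ / 2) * r ^ 2) := integral_const_mul _ _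
      _ ≤ _ := by
          refine mul_le_mul_of_nonneg_left ?_ (by positivity)
          exact setIntegral_le_integral hg (ae_of_all _ fun r => (Real.exp_pos _).le)
  rw [abs_mul, abs_of_pos (Real.exp_pos _)]
  refine (mul_le_mul_of_nonneg_left hN (Real.exp_pos _).le).trans_eq ?_
  have e : Real.exp (δ * s ^ 2) =
      Real.exp (η * s ^ 2 / 2) * Real.exp (-(η / 2 - δ) * s ^ 2) := by
    rw [← Real.exp_add]
    congr 1
    ring
  rw [e]
  ring

/-! ### The fast system: representation and uniqueness -/

/-- The system in the fast time `s = (t - b) / η`, where `η = ε³`. -/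
structure IsFastSolution (b c₁ c₂ η : ℝ) (x y : ℝ → ℝ) : Prop where
  deriv_fst : ∀ s, HasDerivAt x ((b + η * s) * x s + y s + η * c₁) s
  deriv_snd : ∀ s, HasDerivAt y (η * s * x s + (b + η * s) * y s + η * c₂) s

theorem tendsto_sq_atBot : Tendsto (fun s : ℝ => s ^ 2) atBot atTop := by
  simpa [Function.comp_def] using
    (tendsto_pow_atTop (two_ne_zero (α := ℕ))).comp (tendsto_abs_atBot_atTop (G := ℝ))

theorem IsAiryPair.subgaussian_forcing {η : ℝ} {u v : ℝ → ℝ} (h : IsAiryPair η u v) (c₁ c₂ : ℝ) :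
    SubgaussianGrowth fun s => c₂ * u s - c₁ * v s :=
  (h.subgaussian_fst.const_mul c₂).sub (h.subgaussian_snd.const_mul c₁)

/-- The weight cancels the scalar part `b + η s` of the system and the Airy equation cancels the
rest, so only the forcing survives differentiation. The boundary term at `-∞` vanishes because the
Gaussian beats `u` and `v`. -/
theorem IsFastSolution.representation {b c₁ c₂ η : ℝ} (hη : 0 < η) {x y u v : ℝ → ℝ}
    (hX : IsFastSolution b c₁ c₂ η x y) (hx : Tendsto x atBot (𝓝 0)) (hy : Tendsto y atBot (𝓝 0))
    (h : IsAiryPair η u v) (s : ℝ) :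
    gaussWeight b η s * (y s * u s - x s * v s) =
      η * forcingIntegral b η (fun r => c₂ * u r - c₁ * v r) s := by
  have hd : ∀ s, HasDerivAt (fun s => gaussWeight b η s * (y s * u s - x s * v s))
      (η * (gaussWeight b η s * (c₂ * u s - c₁ * v s))) s := fun s => by
    refine ((hasDerivAt_gaussWeight b η s).mul (((hX.deriv_snd s).mul (h.deriv_fst s)).sub
      ((hX.deriv_fst s).mul (h.deriv_snd s)))).congr_deriv ?_
    simp only [Pi.sub_apply, Pi.mul_apply]
    ring
  have hlim : Tendsto (fun s => gaussWeight b η s * (y s * u s - x s * v s)) atBot (𝓝 0) := by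
    have h1 := (h.subgaussian_fst.tendsto_zero b hη tendsto_sq_atBot).mul hy
    have h2 := (h.subgaussian_snd.tendsto_zero b hη tendsto_sq_atBot).mul hx
    refine (h1.sub h2).congr' (Eventually.of_forall fun s => by ring) |>.trans_eq ?_
    simp
  have := integral_Iic_of_hasDerivAt_of_tendsto' (a := s) (fun r _ => hd r)
    (((h.subgaussian_forcing c₁ c₂).integrable b hη).const_mul η).integrableOn hlim
  rw [sub_zero, integral_const_mul] at this
  exact this.symm

theorem IsAiryPair.wronskian {η : ℝ} {u₁ v₁ u₂ v₂ : ℝ → ℝ} (h₁ : IsAiryPair η u₁ v₁)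
    (h₂ : IsAiryPair η u₂ v₂) (s : ℝ) :
    u₁ s * v₂ s - v₁ s * u₂ s = u₁ 0 * v₂ 0 - v₁ 0 * u₂ 0 := by
  have hd : ∀ s, HasDerivAt (fun s => u₁ s * v₂ s - v₁ s * u₂ s) 0 s := fun s =>
    (((h₁.deriv_fst s).mul (h₂.deriv_snd s)).sub ((h₁.deriv_snd s).mul (h₂.deriv_fst s))).congr_deriv
      (by ring)
  exact is_const_of_deriv_eq_zero (fun s => (hd s).differentiableAt) (fun s => (hd s).deriv) s 0

theorem exists_airy_basis (η : ℝ) :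
    ∃ u₁ v₁ u₂ v₂ : ℝ → ℝ, IsAiryPair η u₁ v₁ ∧ IsAiryPair η u₂ v₂ ∧
      ∀ s, u₁ s * v₂ s - v₁ s * u₂ s = 1 := by
  obtain ⟨u₁, v₁, h₁, hu₁, hv₁⟩ := exists_isAiryPair η 1 0
  obtain ⟨u₂, v₂, h₂, hu₂, hv₂⟩ := exists_isAiryPair η 0 1
  refine ⟨u₁, v₁, u₂, v₂, h₁, h₂, fun s => ?_⟩
  rw [h₁.wronskian h₂, hu₁, hv₁, hu₂, hv₂]
  norm_num

theorem IsFastSolution.unique {b c₁ c₂ η : ℝ} (hη : 0 < η) {x y x' y' : ℝ → ℝ}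
    (hX : IsFastSolution b c₁ c₂ η x y) (hx : Tendsto x atBot (𝓝 0)) (hy : Tendsto y atBot (𝓝 0))
    (hX' : IsFastSolution b c₁ c₂ η x' y') (hx' : Tendsto x' atBot (𝓝 0))
    (hy' : Tendsto y' atBot (𝓝 0)) (s : ℝ) : x s = x' s ∧ y s = y' s := by
  obtain ⟨u₁, v₁, u₂, v₂, h₁, h₂, hW⟩ := exists_airy_basis η
  have e₁ := mul_left_cancel₀ (gaussWeight_pos b η s).ne'
    ((hX.representation hη hx hy h₁ s).trans (hX'.representation hη hx' hy' h₁ s).symm)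
  have e₂ := mul_left_cancel₀ (gaussWeight_pos b η s).ne'
    ((hX.representation hη hx hy h₂ s).trans (hX'.representation hη hx' hy' h₂ s).symm)
  have hWs := hW s
  constructor
  · linear_combination u₂ s * e₁ - u₁ s * e₂ - (x s - x' s) * hWs
  · linear_combination v₂ s * e₁ - v₁ s * e₂ - (y s - y' s) * hWs

/-! ### Existence: decay at `-∞` -/

theorem tendsto_affine_atBot (b : ℝ) {η : ℝ} (hη : 0 < η) :
    Tendsto (fun s : ℝ => b + η * s) atBot atBot :=
  tendsto_atBot_add_const_left _ _ (tendsto_id.const_mul_atBot hη)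

/-- A barrier estimate: `E' ≤ t E + C`, with `t = b + η s`, forces `E ≤ C / (-t)` near `-∞` as soon
as `E` has no component along the growing homogeneous solution. -/
theorem le_div_of_deriv_le {b η C : ℝ} (hη : 0 < η) (hC : 0 ≤ C) {E E' : ℝ → ℝ} {s₀ : ℝ}
    (hs₀ : b + η * s₀ < 0) (hE : ∀ s, HasDerivAt E (E' s) s)
    (hE' : ∀ s ≤ s₀, E' s ≤ (b + η * s) * E s + C)
    (hlim : Tendsto (fun s => gaussWeight b η s * E s) atBot (𝓝 0)) {s : ℝ} (hs : s ≤ s₀) :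
    E s ≤ C / (-(b + η * s)) := by
  have hneg : ∀ r ≤ s₀, b + η * r < 0 := fun r hr => by nlinarith
  -- With `t = b + η r`, the barrier `B = C / (-t)` satisfies `t B + C = 0` and `B' ≥ 0`. As the
  -- weight has logarithmic derivative `-t`, the weighted difference `E - B` is nonincreasing; it
  -- starts from 0 at `-∞`.
  have hd : ∀ r ≤ s₀, HasDerivAt
      (fun r => gaussWeight b η r * (E r - C / (-(b + η * r))))
      (gaussWeight b η r * (E' r - ((b + η * r) * E r + C) - C * η / (b + η * r) ^ 2)) r :=
    fun r hr => by
      have hr' := hneg r hr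
      have h1 : HasDerivAt (fun r : ℝ => -(b + η * r)) (-η) r := by
        refine (((hasDerivAt_id r).const_mul η).const_add b).neg.congr_deriv (by simp)
      refine ((hasDerivAt_gaussWeight b η r).mul ((hE r).sub
        ((hasDerivAt_const r C).div h1 (by linarith)))).congr_deriv ?_
      have : b + η * r ≠ 0 := hr'.ne
      simp only [Pi.sub_apply, Pi.div_apply]
      field_simp
      ring
  have hanti : AntitoneOn (fun r => gaussWeight b η r * (E r - C / (-(b + η * r)))) (Iic s₀) := by
    refine antitoneOn_of_hasDerivWithinAt_nonpos (convex_Iic s₀)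
      (fun r hr => (hd r hr).continuousAt.continuousWithinAt)
      (fun r hr => (hd r (interior_subset (s := Iic s₀) hr)).hasDerivWithinAt) fun r hr => ?_
    have hr' := hE' r (interior_subset (s := Iic s₀) hr)
    have : 0 ≤ C * η / (b + η * r) ^ 2 := by positivity
    exact mul_nonpos_of_nonneg_of_nonpos (gaussWeight_pos _ _ _).le (by linarith)
  have hlim' : Tendsto (fun r => gaussWeight b η r * (E r - C / (-(b + η * r)))) atBot (𝓝 0) := by
    have h1 : SubgaussianGrowth fun _ => (1 : ℝ) :=
      ⟨continuous_const, fun δ hδ => ⟨1, zero_le_one, fun s => by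
        simpa using Real.one_le_exp (show 0 ≤ δ * s ^ 2 by positivity)⟩⟩
    have h2 := h1.tendsto_zero b hη tendsto_sq_atBot
    have h3 : Tendsto (fun r : ℝ => C / (-(b + η * r))) atBot (𝓝 0) :=
      (tendsto_neg_atBot_atTop.comp (tendsto_affine_atBot b hη)).const_div_atTop C
    refine (hlim.sub (h2.mul h3)).congr' (Eventually.of_forall fun s => by ring) |>.trans_eq ?_
    simp
  have h0 : gaussWeight b η s * (E s - C / (-(b + η * s))) ≤ 0 := by
    refine ge_of_tendsto hlim' ?_
    filter_upwards [Iic_mem_atBot s] with r hr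
    exact hanti (le_trans hr hs) hs hr
  have := nonpos_of_mul_nonpos_right h0 (gaussWeight_pos b η s)
  linarith

theorem tendsto_zero_of_sq_le {l : Filter ℝ} {x g : ℝ → ℝ} (hg : Tendsto g l (𝓝 0))
    (h : ∀ᶠ s in l, x s ^ 2 ≤ g s) : Tendsto x l (𝓝 0) := by
  refine squeeze_zero_norm' (h.mono fun s hs => Real.abs_le_sqrt hs) ?_
  simpa [Function.comp_def] using (Real.continuous_sqrt.tendsto 0).comp hg

/-- In the energy `-η s x² + y²` the coupling terms cancel, leaving damping at rate `2 (b + η s)`.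
Half of it absorbs the forcing by completing squares; the other half feeds the barrier estimate. -/
theorem IsFastSolution.tendsto_zero {b c₁ c₂ η : ℝ} (hη : 0 < η) {x y : ℝ → ℝ}
    (hX : IsFastSolution b c₁ c₂ η x y)
    (hlim : Tendsto (fun s => gaussWeight b η s * (-(η * s) * x s ^ 2 + y s ^ 2)) atBot (𝓝 0)) :
    Tendsto x atBot (𝓝 0) ∧ Tendsto y atBot (𝓝 0) := by
  set C : ℝ := η ^ 2 * (2 * c₁ ^ 2 + c₂ ^ 2) with hC
  -- To the left of `s₀`, `p = -η s` and `T = -(b + η s)` satisfy `T ≥ 1` and `p ≤ 2 T`, which is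
  -- what absorbing the forcing requires.
  set s₀ : ℝ := -((2 * |b| + 2) / η) with hs₀
  have hs₀' : η * s₀ = -(2 * |b| + 2) := by
    rw [hs₀]
    field_simp
  have hp : ∀ s ≤ s₀, 2 * |b| + 2 ≤ -(η * s) := fun s hs => by
    have := mul_le_mul_of_nonneg_left hs hη.le
    linarith
  have hE : ∀ s, HasDerivAt (fun s => -(η * s) * x s ^ 2 + y s ^ 2)
      (2 * (b + η * s) * (-(η * s) * x s ^ 2 + y s ^ 2) - η * x s ^ 2 +
        2 * η * (-(η * s) * x s * c₁ + y s * c₂)) s := fun s => by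
    have h1 : HasDerivAt (fun s : ℝ => -(η * s)) (-η) s :=
      ((hasDerivAt_id s).const_mul η).neg.congr_deriv (by simp)
    refine ((h1.mul ((hX.deriv_fst s).pow 2)).add ((hX.deriv_snd s).pow 2)).congr_deriv ?_
    rw [show (2 : ℕ) - 1 = 1 from rfl]
    simp only [Pi.pow_apply]
    push_cast
    ring
  have hE' : ∀ s ≤ s₀, 2 * (b + η * s) * (-(η * s) * x s ^ 2 + y s ^ 2) - η * x s ^ 2 +
      2 * η * (-(η * s) * x s * c₁ + y s * c₂) ≤
      (b + η * s) * (-(η * s) * x s ^ 2 + y s ^ 2) + C := fun s hs => by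
    have hp := hp s hs
    have hb := le_abs_self b
    have hb0 := abs_nonneg b
    obtain ⟨T, hT⟩ : ∃ T, T = -(b + η * s) := ⟨_, rfl⟩
    obtain ⟨p, hp'⟩ : ∃ p, p = -(η * s) := ⟨_, rfl⟩
    have ht : b + η * s = -T := by rw [hT, neg_neg]
    rw [← hp'] at hp
    rw [ht, ← hp', hC]
    have hT1 : 1 ≤ T := by linarith
    have hpT : p ≤ 2 * T := by linarith
    have k1 : 0 ≤ 2 * η ^ 2 * c₁ ^ 2 + T * p * x s ^ 2 - 2 * η * p * x s * c₁ := by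
      have : 0 ≤ T * (2 * η ^ 2 * c₁ ^ 2 + T * p * x s ^ 2 - 2 * η * p * x s * c₁) := by
        have e1 : 0 ≤ p * (T * x s - η * c₁) ^ 2 := mul_nonneg (by linarith) (sq_nonneg _)
        have e2 : 0 ≤ (η * c₁) ^ 2 * (2 * T - p) := mul_nonneg (sq_nonneg _) (by linarith)
        linarith
      exact nonneg_of_mul_nonneg_right this (by linarith)
    have k2 : 0 ≤ η ^ 2 * c₂ ^ 2 + T * y s ^ 2 - 2 * η * y s * c₂ := by
      have e1 : 0 ≤ (T - 1) * y s ^ 2 := mul_nonneg (by linarith) (sq_nonneg _)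
      linarith [sq_nonneg (y s - η * c₂)]
    have k3 : 0 ≤ η * x s ^ 2 := by positivity
    linarith
  have hbd : ∀ s ≤ s₀, -(η * s) * x s ^ 2 + y s ^ 2 ≤ C / (-(b + η * s)) := fun s hs =>
    le_div_of_deriv_le hη (by positivity)
      (by linarith [hs₀', le_abs_self b, abs_nonneg b]) hE hE' hlim hs
  have hg : Tendsto (fun r : ℝ => C / (-(b + η * r))) atBot (𝓝 0) :=
    (tendsto_neg_atBot_atTop.comp (tendsto_affine_atBot b hη)).const_div_atTop C
  constructor <;> refine tendsto_zero_of_sq_le hg ?_ <;>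
    filter_upwards [Iic_mem_atBot s₀] with s hs <;>
    have h1 := hbd s hs <;> have h2 := hp s hs <;> have h3 := abs_nonneg b
  · have := mul_le_mul_of_nonneg_right (show 1 ≤ -(η * s) by linarith) (sq_nonneg (x s))
    linarith [sq_nonneg (y s)]
  · have := mul_nonneg (show 0 ≤ -(η * s) by linarith) (sq_nonneg (x s))
    linarith

theorem IsFastSolution.exists (b c₁ c₂ : ℝ) {η : ℝ} (hη : 0 < η) :
    ∃ x y : ℝ → ℝ, IsFastSolution b c₁ c₂ η x y ∧
      Tendsto x atBot (𝓝 0) ∧ Tendsto y atBot (𝓝 0) := by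
  obtain ⟨u₁, v₁, u₂, v₂, h₁, h₂, hW⟩ := exists_airy_basis η
  have q₁ := h₁.subgaussian_forcing c₁ c₂
  have q₂ := h₂.subgaussian_forcing c₁ c₂
  set N₁ := forcingIntegral b η fun s => c₂ * u₁ s - c₁ * v₁ s
  set N₂ := forcingIntegral b η fun s => c₂ * u₂ s - c₁ * v₂ s
  have hN₁ := q₁.hasDerivAt_forcingIntegral b hη
  have hN₂ := q₂.hasDerivAt_forcingIntegral b hη
  have hinv : ∀ s, HasDerivAt (fun s => η * (gaussWeight b η s)⁻¹)
      (η * ((b + η * s) * (gaussWeight b η s)⁻¹)) s := fun s => by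
    refine (((hasDerivAt_gaussWeight b η s).inv (gaussWeight_pos b η s).ne').const_mul
      η).congr_deriv ?_
    have := (gaussWeight_pos b η s).ne'
    field_simp
  -- Cramer's rule applied to the representation formulas for the two basis pairs; equivalently,
  -- variation of constants.
  have hX : IsFastSolution b c₁ c₂ η
      (fun s => η * (gaussWeight b η s)⁻¹ * (N₁ s * u₂ s - N₂ s * u₁ s))
      (fun s => η * (gaussWeight b η s)⁻¹ * (N₁ s * v₂ s - N₂ s * v₁ s)) := by
    refine ⟨fun s => ?_, fun s => ?_⟩ <;> have hWs := hW s <;>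
      have hw := mul_inv_cancel₀ (gaussWeight_pos b η s).ne'
    · refine ((hinv s).mul (((hN₁ s).mul (h₂.deriv_fst s)).sub
        ((hN₂ s).mul (h₁.deriv_fst s)))).congr_deriv ?_
      simp only [Pi.sub_apply, Pi.mul_apply]
      linear_combination η * c₁ * (u₁ s * v₂ s - v₁ s * u₂ s) * hw + η * c₁ * hWs
    · refine ((hinv s).mul (((hN₁ s).mul (h₂.deriv_snd s)).sub
        ((hN₂ s).mul (h₁.deriv_snd s)))).congr_deriv ?_
      simp only [Pi.sub_apply, Pi.mul_apply]
      linear_combination η * c₂ * (u₁ s * v₂ s - v₁ s * u₂ s) * hw + η * c₂ * hWs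
  refine ⟨_, _, hX, hX.tendsto_zero hη ?_⟩
  have g₁ := q₁.forcingIntegral_neg_abs b hη
  have g₂ := q₂.forcingIntegral_neg_abs b hη
  have gx := (g₁.mul h₂.subgaussian_fst).sub (g₂.mul h₁.subgaussian_fst)
  have gy := (g₁.mul h₂.subgaussian_snd).sub (g₂.mul h₁.subgaussian_snd)
  have hlim := (((((gx.mul gx).id_mul.const_mul (-η)).add (gy.mul gy)).const_mul
    (η ^ 2)).tendsto_zero (-b) hη tendsto_sq_atBot)
  refine hlim.congr' ?_
  filter_upwards [Iic_mem_atBot 0] with s hs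
  -- The energy is quadratic in the solution, hence carries two inverse weights, of which the outer
  -- weight removes one. The remaining inverse weight is split into one factor `exp (η s² / 2)` for
  -- each forcing integral, with a decaying weight of parameter `-b` left over.
  have e : gaussWeight (-b) η s * Real.exp (η * s ^ 2 / 2) * Real.exp (η * s ^ 2 / 2) =
      (gaussWeight b η s)⁻¹ := by
    rw [gaussWeight, gaussWeight, ← Real.exp_neg, ← Real.exp_add, ← Real.exp_add]
    congr 1
    ring
  have hw := mul_inv_cancel₀ (gaussWeight_pos b η s).ne'
  rw [abs_of_nonpos hs, neg_neg]
  set G := (N₁ s * u₂ s - N₂ s * u₁ s) with hG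
  set H := (N₁ s * v₂ s - N₂ s * v₁ s) with hH
  linear_combination η ^ 2 * (-(η * s) * G ^ 2 + H ^ 2) * (e - (gaussWeight b η s)⁻¹ * hw)

/-! ### Gaussian averages of Airy functions -/

/-- Uniformity in the mean `m` and the deviation `r` provides the dominating function when Gaussian
averages are differentiated in `r`. -/
theorem SubgaussianGrowth.exists_abs_comp_affine_le {q : ℝ → ℝ} (h : SubgaussianGrowth q) (R : ℝ)
    {δ : ℝ} (hδ : 0 < δ) :
    ∃ C, 0 ≤ C ∧ ∀ m r x : ℝ, |m| ≤ R → |r| ≤ R → |q (m + r * x)| ≤ C * Real.exp (δ * x ^ 2) := by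
  obtain ⟨C, hC, hb⟩ := h.bound (δ / (2 * R ^ 2 + 1)) (by positivity)
  refine ⟨C * Real.exp δ, by positivity, fun m r x hm hr => (hb _).trans ?_⟩
  rw [mul_assoc, ← Real.exp_add]
  refine mul_le_mul_of_nonneg_left (Real.exp_le_exp.2 ?_) hC
  have hR : 0 ≤ R := (abs_nonneg m).trans hm
  have h1 : m ^ 2 ≤ R ^ 2 := sq_le_sq.2 (by rwa [abs_of_nonneg hR])
  have h2 : r ^ 2 ≤ R ^ 2 := sq_le_sq.2 (by rwa [abs_of_nonneg hR])
  have h3 := mul_le_mul_of_nonneg_right h2 (sq_nonneg x)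
  have h4 : (m + r * x) ^ 2 ≤ (2 * R ^ 2 + 1) * (1 + x ^ 2) := by
    nlinarith [sq_nonneg (m - r * x), sq_nonneg x]
  calc _ ≤ δ / (2 * R ^ 2 + 1) * ((2 * R ^ 2 + 1) * (1 + x ^ 2)) := by gcongr
    _ = δ + δ * x ^ 2 := by
      field_simp

theorem SubgaussianGrowth.comp_affine {q : ℝ → ℝ} (h : SubgaussianGrowth q) (m r : ℝ) :
    SubgaussianGrowth fun x => q (m + r * x) := by
  refine ⟨h.continuous.comp (by fun_prop), fun δ hδ => ?_⟩
  obtain ⟨C, hC, hb⟩ := h.exists_abs_comp_affine_le (max |m| |r|) hδ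
  exact ⟨C, hC, fun x => hb m r x (le_max_left _ _) (le_max_right _ _)⟩

theorem gaussWeight_zero_one (x : ℝ) : gaussWeight 0 1 x = Real.exp (-(1 / 2) * x ^ 2) := by
  rw [gaussWeight]
  congr 1
  ring

/-- Gaussian integration by parts. -/
theorem integral_gaussWeight_id_mul {q q' : ℝ → ℝ} (hq : SubgaussianGrowth q)
    (hq' : SubgaussianGrowth q') (hd : ∀ x, HasDerivAt q (q' x) x) :
    ∫ x, gaussWeight 0 1 x * (x * q x) = ∫ x, gaussWeight 0 1 x * q' x := by
  have h := integral_eq_zero_of_hasDerivAt_of_integrable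
    (f := fun x => gaussWeight 0 1 x * q x)
    (f' := fun x => gaussWeight 0 1 x * q' x - gaussWeight 0 1 x * (x * q x))
    (fun x => ((hasDerivAt_gaussWeight 0 1 x).mul (hd x)).congr_deriv (by ring))
    ((hq'.integrable 0 one_pos).sub (hq.id_mul.integrable 0 one_pos)) (hq.integrable 0 one_pos)
  rw [integral_sub (hq'.integrable 0 one_pos) (hq.id_mul.integrable 0 one_pos)] at h
  linarith

/-- Differentiation of a Gaussian average with respect to its mean and its standard deviation. -/
theorem hasDerivAt_integral_gaussWeight {q q' m m' : ℝ → ℝ} (hq : SubgaussianGrowth q)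
    (hq' : SubgaussianGrowth q') (hd : ∀ x, HasDerivAt q (q' x) x)
    (hm : ∀ r, HasDerivAt m (m' r) r) (hm' : Continuous m') (r : ℝ) :
    HasDerivAt (fun r => ∫ x, gaussWeight 0 1 x * q (m r + r * x))
      (∫ x, gaussWeight 0 1 x * (q' (m r + r * x) * (m' r + x))) r := by
  have hmc : Continuous m := continuous_iff_continuousAt.2 fun r => (hm r).continuousAt
  obtain ⟨R₁, hR₁⟩ := (isCompact_closedBall r 1).exists_bound_of_continuousOn hmc.continuousOn
  obtain ⟨R₂, hR₂⟩ := (isCompact_closedBall r 1).exists_bound_of_continuousOn hm'.continuousOn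
  obtain ⟨R₃, hR₃⟩ := (isCompact_closedBall r 1).exists_bound_of_continuousOn
    (f := fun x : ℝ => x) continuousOn_id
  obtain ⟨C, hC, hb⟩ := hq'.exists_abs_comp_affine_le (max R₁ R₃) (δ := 1 / 8) (by norm_num)
  refine (hasDerivAt_integral_of_dominated_loc_of_deriv_le
    (F' := fun r x => gaussWeight 0 1 x * (q' (m r + r * x) * (m' r + x)))
    (bound := fun x => C * (R₂ + (1 + 1 / (1 / 8))) * Real.exp (-(1 / 4) * x ^ 2))
    (Metric.ball_mem_nhds r one_pos)
    (Eventually.of_forall fun r => ?_) ?_ ?_ (ae_of_all _ fun x ρ hρ => ?_)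
    ((integrable_exp_neg_mul_sq (by norm_num)).const_mul _) (ae_of_all _ fun x ρ _ => ?_)).2
  · exact ((hq.comp_affine _ _).integrable 0 one_pos).aestronglyMeasurable
  · exact (hq.comp_affine _ _).integrable 0 one_pos
  · have h1 := hq'.continuous
    have h2 := continuous_gaussWeight 0 1
    exact Continuous.aestronglyMeasurable (by fun_prop)
  · have hρ' := Metric.ball_subset_closedBall hρ
    have e1 := hb (m ρ) ρ x ((hR₁ ρ hρ').trans (le_max_left _ _))
      ((hR₃ ρ hρ').trans (le_max_right _ _))
    have hR₂0 : 0 ≤ R₂ := (norm_nonneg _).trans (hR₂ ρ hρ')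
    have e2 : |m' ρ + x| ≤ (R₂ + (1 + 1 / (1 / 8))) * Real.exp (1 / 8 * x ^ 2) := by
      refine (abs_add_le _ _).trans ?_
      rw [add_mul]
      refine add_le_add ((hR₂ ρ hρ').trans ?_) (abs_le_mul_exp_mul_sq (by norm_num) x)
      exact le_mul_of_one_le_right hR₂0 (Real.one_le_exp (by positivity))
    have e3 : Real.exp (-(1 / 4) * x ^ 2) = Real.exp (-(1 / 2) * x ^ 2) *
        (Real.exp (1 / 8 * x ^ 2) * Real.exp (1 / 8 * x ^ 2)) := by
      rw [← Real.exp_add, ← Real.exp_add]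
      congr 1
      ring
    rw [Real.norm_eq_abs, abs_mul, abs_of_pos (gaussWeight_pos _ _ _), gaussWeight_zero_one,
      abs_mul, e3]
    calc _ ≤ Real.exp (-(1 / 2) * x ^ 2) * ((C * Real.exp (1 / 8 * x ^ 2)) *
          ((R₂ + (1 + 1 / (1 / 8))) * Real.exp (1 / 8 * x ^ 2))) := by gcongr
      _ = _ := by ring
  · refine HasDerivAt.const_mul _ ((hd _).comp ρ ((hm ρ).add ?_))
    simpa using (hasDerivAt_id ρ).mul_const x

theorem hasDerivAt_quartic (σ η r : ℝ) :
    HasDerivAt (fun r : ℝ => σ - η * r ^ 4 / 4) (-(η * r ^ 3)) r := by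
  refine ((((hasDerivAt_pow 4 r).const_mul η).div_const 4).const_sub σ).congr_deriv ?_
  rw [show (4 : ℕ) - 1 = 3 from rfl]
  push_cast
  ring

/-- The heat flow acts on Airy functions by translation and multiplication by an exponential. -/
theorem IsAiryPair.integral_gaussWeight_affine {η : ℝ} {u v : ℝ → ℝ} (h : IsAiryPair η u v)
    (σ r : ℝ) :
    (∫ x, gaussWeight 0 1 x * u (σ - η * r ^ 4 / 4 + r * x) =
      √(2 * Real.pi) * Real.exp (η * σ * r ^ 2 / 2 - η ^ 2 * r ^ 6 / 24) * u σ) ∧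
    ∫ x, gaussWeight 0 1 x * v (σ - η * r ^ 4 / 4 + r * x) =
      √(2 * Real.pi) * Real.exp (η * σ * r ^ 2 / 2 - η ^ 2 * r ^ 6 / 24) *
        (v σ + η * r ^ 2 / 2 * u σ) := by
  -- The drift `m' = -η r³` is chosen to cancel the `B` term in `A'`, leaving `A' = η r m A`.
  -- Integrations by parts `S1`–`S3` express all moments through `A` and `B`.
  set m : ℝ → ℝ := fun r => σ - η * r ^ 4 / 4 with hm
  set A : ℝ → ℝ := fun r => ∫ x, gaussWeight 0 1 x * u (m r + r * x) with hA
  set B : ℝ → ℝ := fun r => ∫ x, gaussWeight 0 1 x * v (m r + r * x) with hB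
  have hu := h.subgaussian_fst
  have hv := h.subgaussian_snd
  have hw : SubgaussianGrowth fun s => η * s * u s := by
    simpa only [mul_assoc] using hu.id_mul.const_mul η
  have hmc : Continuous fun r : ℝ => -(η * r ^ 3) := by fun_prop
  have hlin : ∀ r x : ℝ, HasDerivAt (fun x : ℝ => m r + r * x) r x := fun r x => by
    simpa using ((hasDerivAt_id x).const_mul r).const_add (m r)
  have hU : ∀ r, SubgaussianGrowth fun x => u (m r + r * x) := fun r => hu.comp_affine _ _
  have hV : ∀ r, SubgaussianGrowth fun x => v (m r + r * x) := fun r => hv.comp_affine _ _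
  have hU' : ∀ r x, HasDerivAt (fun x => u (m r + r * x)) (r * v (m r + r * x)) x := fun r x =>
    ((h.deriv_fst _).comp x (hlin r x)).congr_deriv (mul_comm _ _)
  have hV' : ∀ r x, HasDerivAt (fun x => v (m r + r * x))
      (r * η * m r * u (m r + r * x) + r * η * r * (x * u (m r + r * x))) x := fun r x =>
    ((h.deriv_snd _).comp x (hlin r x)).congr_deriv (by ring)
  have S1 : ∀ r, ∫ x, gaussWeight 0 1 x * (x * u (m r + r * x)) = r * B r := fun r => by
    rw [integral_gaussWeight_id_mul (hU r) ((hV r).const_mul r) (hU' r), hB, ← integral_const_mul]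
    exact integral_congr_ae (ae_of_all _ fun x => by ring)
  have iU : ∀ r, Integrable fun x => gaussWeight 0 1 x * u (m r + r * x) :=
    fun r => (hU r).integrable 0 one_pos
  have iV : ∀ r, Integrable fun x => gaussWeight 0 1 x * v (m r + r * x) :=
    fun r => (hV r).integrable 0 one_pos
  have iU1 : ∀ r, Integrable fun x => gaussWeight 0 1 x * (x * u (m r + r * x)) :=
    fun r => (hU r).id_mul.integrable 0 one_pos
  have iU2 : ∀ r, Integrable fun x => gaussWeight 0 1 x * (x * (x * u (m r + r * x))) :=
    fun r => (hU r).id_mul.id_mul.integrable 0 one_pos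
  have iV1 : ∀ r, Integrable fun x => gaussWeight 0 1 x * (x * v (m r + r * x)) :=
    fun r => (hV r).id_mul.integrable 0 one_pos
  have S2 : ∀ r, ∫ x, gaussWeight 0 1 x * (x * v (m r + r * x)) =
      r * η * m r * A r + r * η * r * (r * B r) := fun r => by
    rw [integral_gaussWeight_id_mul (hV r) (((hU r).const_mul _).add ((hU r).id_mul.const_mul _))
      (hV' r), ← S1, hA, ← integral_const_mul, ← integral_const_mul,
      ← integral_add ((iU r).const_mul _) ((iU1 r).const_mul _)]
    exact integral_congr_ae (ae_of_all _ fun x => by ring)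
  have S3 : ∀ r, ∫ x, gaussWeight 0 1 x * (x * (x * u (m r + r * x))) =
      A r + r * (r * η * m r * A r + r * η * r * (r * B r)) := fun r => by
    rw [integral_gaussWeight_id_mul (q' := fun x => u (m r + r * x) + r * (x * v (m r + r * x)))
      (hU r).id_mul ((hU r).add ((hV r).id_mul.const_mul r))
      (fun x => ((hasDerivAt_id x).mul (hU' r x)).congr_deriv (by simp only [id]; ring)),
      ← S2, hA, ← integral_const_mul, ← integral_add (iU r) ((iV1 r).const_mul _)]
    exact integral_congr_ae (ae_of_all _ fun x => by ring)
  have hA' : ∀ r, HasDerivAt A (η * r * m r * A r) r := fun r => by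
    refine (hasDerivAt_integral_gaussWeight hu hv h.deriv_fst (hasDerivAt_quartic σ η) hmc
      r).congr_deriv ?_
    have : ∫ x, gaussWeight 0 1 x * (v (m r + r * x) * (-(η * r ^ 3) + x)) =
        -(η * r ^ 3) * B r + (r * η * m r * A r + r * η * r * (r * B r)) := by
      rw [← S2, hB, ← integral_const_mul, ← integral_add ((iV r).const_mul _) (iV1 r)]
      exact integral_congr_ae (ae_of_all _ fun x => by ring)
    rw [this]
    ring
  have hB' : ∀ r, HasDerivAt B (η * r * (m r * B r + A r)) r := fun r => by
    refine (hasDerivAt_integral_gaussWeight hv hw h.deriv_snd (hasDerivAt_quartic σ η) hmc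
      r).congr_deriv ?_
    have : ∫ x, gaussWeight 0 1 x *
          (η * (m r + r * x) * u (m r + r * x) * (-(η * r ^ 3) + x)) =
        η * m r * -(η * r ^ 3) * A r + (η * (m r + r * -(η * r ^ 3)) * (r * B r) +
          η * r * (A r + r * (r * η * m r * A r + r * η * r * (r * B r)))) := by
      rw [← S3, ← S1, hA, ← integral_const_mul, ← integral_const_mul, ← integral_const_mul,
        ← integral_add ((iU1 r).const_mul _) ((iU2 r).const_mul _),
        ← integral_add ((iU r).const_mul _) (((iU1 r).const_mul _).fun_add ((iU2 r).const_mul _))]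
      exact integral_congr_ae (ae_of_all _ fun x => by ring)
    rw [this]
    ring
  -- Integrating factor: the exponent has derivative `-η r m`. Both `p A` and `p (B - η r² A / 2)`
  -- are then constant in `r`, and `r = 0` gives their values.
  set p : ℝ → ℝ := fun r => Real.exp (-(η * σ * r ^ 2 / 2 - η ^ 2 * r ^ 6 / 24)) with hp
  have hp' : ∀ r, HasDerivAt p (-(η * r * m r) * p r) r := fun r => by
    have : HasDerivAt (fun r : ℝ => -(η * σ * r ^ 2 / 2 - η ^ 2 * r ^ 6 / 24))
        (-(η * r * m r)) r := by
      refine ((((hasDerivAt_pow 2 r).const_mul (η * σ)).div_const 2).sub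
        (((hasDerivAt_pow 6 r).const_mul (η ^ 2)).div_const 24)).neg.congr_deriv ?_
      rw [show (2 : ℕ) - 1 = 1 from rfl, show (6 : ℕ) - 1 = 5 from rfl, hm]
      push_cast
      ring
    exact this.exp.congr_deriv (mul_comm _ _)
  have cA : ∀ r, HasDerivAt (fun r => p r * A r) 0 r := fun r =>
    ((hp' r).mul (hA' r)).congr_deriv (by ring)
  have cB : ∀ r, HasDerivAt (fun r => p r * (B r - η * r ^ 2 / 2 * A r)) 0 r := fun r => by
    refine ((hp' r).mul ((hB' r).sub ((((hasDerivAt_pow 2 r).const_mul η).div_const 2).mul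
      (hA' r)))).congr_deriv ?_
    rw [show (2 : ℕ) - 1 = 1 from rfl]
    simp only [Pi.sub_apply, Pi.mul_apply]
    push_cast
    ring
  have eA := is_const_of_deriv_eq_zero (fun s => (cA s).differentiableAt) (fun s => (cA s).deriv) r 0
  have eB := is_const_of_deriv_eq_zero (fun s => (cB s).differentiableAt) (fun s => (cB s).deriv) r 0
  have hγ : ∫ x, gaussWeight 0 1 x = √(2 * Real.pi) := by
    simp_rw [gaussWeight_zero_one, integral_gaussian]
    congr 1
    ring
  have hA0 : A 0 = √(2 * Real.pi) * u σ := by simp [hA, hm, integral_mul_const, hγ]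
  have hB0 : B 0 = √(2 * Real.pi) * v σ := by simp [hB, hm, integral_mul_const, hγ]
  have hp0 : p 0 = 1 := by simp [hp]
  have hpr : Real.exp (η * σ * r ^ 2 / 2 - η ^ 2 * r ^ 6 / 24) * p r = 1 := by
    rw [hp, ← Real.exp_add, add_neg_cancel, Real.exp_zero]
  rw [hp0, hA0] at eA
  rw [hp0, hA0, hB0] at eB
  set Q := Real.exp (η * σ * r ^ 2 / 2 - η ^ 2 * r ^ 6 / 24)
  constructor
  · change A r = _
    linear_combination Q * eA - A r * hpr
  · change B r = _
    linear_combination Q * eB + η * r ^ 2 / 2 * Q * eA - B r * hpr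

theorem integral_eq_mul_integral_comp_affine (f : ℝ → ℝ) (c : ℝ) {r : ℝ} (hr : 0 < r) :
    ∫ s, f s = r * ∫ x, f (c + r * x) := by
  rw [Measure.integral_comp_mul_left (fun y => f (c + y)) r, integral_add_left_eq_self f c,
    abs_of_pos (inv_pos.2 hr), smul_eq_mul, mul_inv_cancel_left₀ hr.ne']

theorem gaussWeight_comp_affine (b : ℝ) {η r : ℝ} (hr : η * r ^ 2 = 1) (x : ℝ) :
    gaussWeight b η (-b * r ^ 2 + r * x) =
      Real.exp (b ^ 2 * r ^ 2 / 2) * gaussWeight 0 1 x := by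
  rw [gaussWeight, gaussWeight, ← Real.exp_add]
  congr 1
  linear_combination (-(b ^ 2 * r ^ 2 / 2) + b * r * x - x ^ 2 / 2) * hr

/-- Completing the square makes the weight a Gaussian of mean `-b r²` and deviation `r = η^(-1/2)`.
The averaging identity is applied at the `σ` with `σ - η r⁴ / 4 = -b r²`. -/
theorem IsAiryPair.integral_gaussWeight {b η r : ℝ} (hr : 0 < r) (hηr : η * r ^ 2 = 1)
    {u v : ℝ → ℝ} (h : IsAiryPair η u v) :
    (∫ s, gaussWeight b η s * u s = r * √(2 * Real.pi) *
      Real.exp ((b ^ 2 / 2 - b / 2 + 1 / 12) * r ^ 2) * u ((1 / 4 - b) * r ^ 2)) ∧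
    ∫ s, gaussWeight b η s * v s = r * √(2 * Real.pi) *
      Real.exp ((b ^ 2 / 2 - b / 2 + 1 / 12) * r ^ 2) *
        (v ((1 / 4 - b) * r ^ 2) + u ((1 / 4 - b) * r ^ 2) / 2) := by
  have key := h.integral_gaussWeight_affine ((1 / 4 - b) * r ^ 2) r
  have e1 : (1 / 4 - b) * r ^ 2 - η * r ^ 4 / 4 = -b * r ^ 2 := by
    linear_combination -(r ^ 2 / 4) * hηr
  have e2 : Real.exp ((b ^ 2 / 2 - b / 2 + 1 / 12) * r ^ 2) = Real.exp (b ^ 2 * r ^ 2 / 2) *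
      Real.exp (η * ((1 / 4 - b) * r ^ 2) * r ^ 2 / 2 - η ^ 2 * r ^ 6 / 24) := by
    rw [← Real.exp_add]
    congr 1
    linear_combination (-((1 / 4 - b) * r ^ 2 / 2) + (η * r ^ 4 + r ^ 2) / 24) * hηr
  have e3 : η * r ^ 2 / 2 = 1 / 2 := by rw [hηr]
  rw [e1, e3] at key
  constructor
  · rw [integral_eq_mul_integral_comp_affine _ (-b * r ^ 2) hr]
    simp_rw [gaussWeight_comp_affine b hηr, mul_assoc]
    rw [integral_const_mul, key.1, e2]
    ring
  · rw [integral_eq_mul_integral_comp_affine _ (-b * r ^ 2) hr]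
    simp_rw [gaussWeight_comp_affine b hηr, mul_assoc]
    rw [integral_const_mul, key.2, e2]
    ring

/-! ### The integral over the whole line is negligible -/

/-- On the oscillatory side Airy functions grow at most algebraically. -/
theorem IsAiryPair.oscillatory_energy_le {η : ℝ} {u v : ℝ → ℝ} (h : IsAiryPair η u v) {s : ℝ}
    (hs : s ≤ -1) :
    v s ^ 2 - η * s * u s ^ 2 ≤ -s * (v (-1) ^ 2 + η * u (-1) ^ 2) := by
  -- Dividing the oscillatory energy by `-s` leaves the nonnegative derivative `v² / s²`, so the
  -- quotient is at most its value at `-1`.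
  have hd : ∀ s ≤ (-1 : ℝ), HasDerivAt (fun s => (v s ^ 2 - η * s * u s ^ 2) / (-s))
      (v s ^ 2 / s ^ 2) s := fun s hs => by
    have hs0 : s ≠ 0 := by linarith
    have h1 : HasDerivAt (fun s : ℝ => η * s) η s := by
      simpa using (hasDerivAt_id s).const_mul η
    refine ((((h.deriv_snd s).pow 2).sub (h1.mul ((h.deriv_fst s).pow 2))).div
      (hasDerivAt_neg s) (neg_ne_zero.2 hs0)).congr_deriv ?_
    rw [show (2 : ℕ) - 1 = 1 from rfl]
    simp only [Pi.sub_apply, Pi.mul_apply, Pi.pow_apply]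
    push_cast
    field_simp
    ring
  have hmono : MonotoneOn (fun s => (v s ^ 2 - η * s * u s ^ 2) / (-s)) (Iic (-1)) :=
    monotoneOn_of_hasDerivWithinAt_nonneg (convex_Iic (-1))
      (fun r hr => (hd r hr).continuousAt.continuousWithinAt)
      (fun r hr => (hd r (interior_subset (s := Iic (-1)) hr)).hasDerivWithinAt)
      fun r _ => by positivity
  have h0 := hmono (mem_Iic.2 hs) (mem_Iic.2 le_rfl) hs
  simp only [neg_neg, div_one, mul_neg, mul_one, neg_mul, sub_neg_eq_add] at h0
  rw [div_le_iff₀ (by linarith)] at h0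
  linarith

/-- The roots of the quadratic are `1/2 ± √3/6`, and the smaller one lies below `1/4`. -/
theorem half_sq_sub_neg {b : ℝ} (hb₁ : 1 / 4 < b) (hb₂ : b < 1 / 2 + √3 / 6) :
    b ^ 2 / 2 - b / 2 + 1 / 12 < 0 := by
  have h3 : √3 ^ 2 = 3 := Real.sq_sqrt (by norm_num)
  have h0 : 1 / 4 < √3 / 6 := by nlinarith [Real.sqrt_nonneg 3]
  nlinarith [mul_pos (show 0 < 1 / 2 + √3 / 6 - b by linarith)
    (show 0 < b - 1 / 2 + √3 / 6 by linarith)]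

theorem mul_exp_neg_mul_le {δ y : ℝ} (hδ : 0 < δ) (hy : 0 < y) :
    y * Real.exp (-δ * y) ≤ 6 / δ ^ 3 * (1 / y) ^ 2 := by
  have h := Real.pow_div_factorial_le_exp (δ * y) (by positivity) 3
  rw [neg_mul, Real.exp_neg, ← div_eq_mul_inv, div_le_iff₀ (Real.exp_pos _)]
  calc y = 6 / δ ^ 3 * (1 / y) ^ 2 * ((δ * y) ^ 3 / Nat.factorial 3) := by
        rw [show ((Nat.factorial 3 : ℕ) : ℝ) = 6 by norm_num [Nat.factorial]]
        field_simp
    _ ≤ _ := by gcongr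

/-- The difference between the distinguished solutions at `-∞` and `+∞` is exponentially small. -/
theorem exists_abs_integral_gaussWeight_le {b : ℝ} (hb₁ : 1 / 4 < b) (hb₂ : b < 1 / 2 + √3 / 6)
    (a d c₁ c₂ : ℝ) :
    ∃ K, ∀ η, 0 < η → η ≤ b - 1 / 4 → ∀ u v, IsAiryPair η u v → u 0 = a → v 0 = d →
      |∫ s, gaussWeight b η s * (c₂ * u s - c₁ * v s)| ≤ K * η ^ 2 := by
  have hneg := half_sq_sub_neg hb₁ hb₂
  obtain ⟨δ, hδ⟩ : ∃ δ, δ = -(b ^ 2 / 2 - b / 2 + 1 / 12) := ⟨_, rfl⟩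
  have hδ0 : 0 < δ := by linarith
  have hb1 : b ≤ 5 / 4 := by
    have : √3 ≤ 2 := Real.sqrt_le_iff.2 (by norm_num)
    linarith
  -- Bounds the energy at `s = -1`, uniformly for `η ≤ 1`: with `k = 1` the exponent there is `1 + η
  -- / 2 ≤ 2`.
  set D : ℝ := (a ^ 2 + d ^ 2) * Real.exp 2 with hD
  have hD0 : 0 ≤ D := by positivity
  set N : ℝ := √(2 * Real.pi) * (|c₂| * √D + |c₁| * (√D + √D / 2)) with hN
  refine ⟨N * (6 / δ ^ 3), fun η hη hηb u v h hu hv => ?_⟩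
  obtain ⟨r, hr⟩ : ∃ r, r = √(1 / η) := ⟨_, rfl⟩
  have hr0 : 0 < r := by rw [hr]; positivity
  have hr2 : r ^ 2 = 1 / η := by rw [hr, Real.sq_sqrt (by positivity)]
  have hηr : η * r ^ 2 = 1 := by rw [hr2]; field_simp
  have hη1 : η ≤ 1 := by linarith
  set σ := (1 / 4 - b) * r ^ 2 with hσ
  have hσ1 : σ ≤ -1 := by
    have := mul_le_mul_of_nonneg_right hηb (sq_nonneg r)
    rw [hσ]
    linarith
  have hσ2 : -σ ≤ r ^ 2 := by
    have := mul_le_mul_of_nonneg_right hb1 (sq_nonneg r)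
    rw [hσ]
    linarith
  have e1 := h.energy_le one_pos (-1)
  have e2 : v (-1) ^ 2 + η * u (-1) ^ 2 ≤ D := by
    have h1 : Real.exp (1 * |(-1 : ℝ)| + |η| * (-1) ^ 2 / (2 * 1)) ≤ Real.exp 2 := by
      refine Real.exp_le_exp.2 ?_
      rw [abs_of_pos hη, abs_neg, abs_one]
      linarith
    have h2 := mul_le_mul_of_nonneg_right hη1 (sq_nonneg (u (-1)))
    have h3 := mul_le_mul_of_nonneg_left h1 (show 0 ≤ a ^ 2 + d ^ 2 by positivity)
    rw [hu, hv] at e1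
    simp only [one_pow, one_mul] at e1 h2 h3
    linarith
  have e3 := h.oscillatory_energy_le hσ1
  have e4 : -σ * (v (-1) ^ 2 + η * u (-1) ^ 2) ≤ -σ * D :=
    mul_le_mul_of_nonneg_left e2 (by linarith)
  have hvσ : |v σ| ≤ √D * r := by
    refine abs_le_of_sq_le_sq ?_ (by positivity)
    rw [mul_pow, Real.sq_sqrt hD0]
    have h1 : 0 ≤ -σ * (η * u σ ^ 2) := mul_nonneg (by linarith) (by positivity)
    have h2 := mul_le_mul_of_nonneg_right hσ2 hD0
    linarith
  have huσ : |u σ| ≤ √D * r := by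
    refine abs_le_of_sq_le_sq ?_ (by positivity)
    rw [mul_pow, Real.sq_sqrt hD0]
    have h1 : -σ * (η * u σ ^ 2) ≤ -σ * D := by linarith [sq_nonneg (v σ)]
    have h2 := le_of_mul_le_mul_left h1 (by linarith)
    calc u σ ^ 2 = η * u σ ^ 2 * r ^ 2 := by linear_combination -(u σ ^ 2) * hηr
      _ ≤ D * r ^ 2 := by gcongr
  have hint : ∫ s, gaussWeight b η s * (c₂ * u s - c₁ * v s) =
      r * √(2 * Real.pi) * Real.exp (-δ * r ^ 2) * (c₂ * u σ - c₁ * (v σ + u σ / 2)) := by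
    obtain ⟨k1, k2⟩ := h.integral_gaussWeight (b := b) hr0 hηr
    have i1 := (h.subgaussian_fst.integrable b hη).const_mul c₂
    have i2 := (h.subgaussian_snd.integrable b hη).const_mul c₁
    calc _ = ∫ s, (c₂ * (gaussWeight b η s * u s) - c₁ * (gaussWeight b η s * v s)) :=
          integral_congr_ae (ae_of_all _ fun s => by ring)
      _ = _ := by
          rw [integral_sub i1 i2, integral_const_mul, integral_const_mul, k1, k2, hδ, neg_neg]
          ring
  have hcomb : |c₂ * u σ - c₁ * (v σ + u σ / 2)| ≤ (|c₂| * √D + |c₁| * (√D + √D / 2)) * r := by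
    calc _ ≤ |c₂ * u σ| + |c₁ * (v σ + u σ / 2)| := abs_sub _ _
      _ ≤ |c₂| * |u σ| + |c₁| * (|v σ| + |u σ| / 2) := by
          rw [abs_mul, abs_mul]
          gcongr
          refine (abs_add_le _ _).trans_eq ?_
          rw [abs_div, abs_of_pos (two_pos (α := ℝ))]
      _ ≤ |c₂| * (√D * r) + |c₁| * (√D * r + √D * r / 2) := by gcongr
      _ = _ := by ring
  rw [hint, abs_mul, abs_of_pos (by positivity)]
  calc _ ≤ r * √(2 * Real.pi) * Real.exp (-δ * r ^ 2) *
        ((|c₂| * √D + |c₁| * (√D + √D / 2)) * r) := by gcongr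
    _ = N * (r ^ 2 * Real.exp (-δ * r ^ 2)) := by rw [hN]; ring
    _ ≤ N * (6 / δ ^ 3 * (1 / r ^ 2) ^ 2) :=
        mul_le_mul_of_nonneg_left (mul_exp_neg_mul_le hδ0 (by positivity)) (by positivity)
    _ = _ := by rw [hr2, one_div_one_div]; ring

/-! ### Taylor expansion of the integrand in `η` -/

theorem abs_le_of_abs_deriv_le {f f' : ℝ → ℝ} (hd : ∀ s, HasDerivAt f (f' s) s) (h0 : f 0 = 0)
    {g : ℝ → ℝ} {K : ℝ} {n : ℕ} (hK : 0 ≤ K) (hg : MonotoneOn g (Ici 0)) (hg0 : ∀ s, 0 ≤ g s)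
    (hf' : ∀ s, 0 ≤ s → |f' s| ≤ K * s ^ n * g s) {s : ℝ} (hs : 0 ≤ s) :
    |f s| ≤ K * s ^ (n + 1) * g s := by
  have := norm_image_sub_le_of_norm_deriv_le_segment' (f := f) (f' := f') (C := K * s ^ n * g s)
    (a := 0) (b := s) (fun x _ => (hd x).hasDerivWithinAt) (fun x hx => (hf' x hx.1).trans ?_) s
    (right_mem_Icc.2 hs)
  · rw [h0, sub_zero, sub_zero, Real.norm_eq_abs] at this
    exact this.trans_eq (by ring)
  · have h1 := hg hx.1 hs hx.2.le
    have h2 := hx.1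
    have h3 := hx.2.le
    have h4 := hg0 x
    gcongr

theorem monotoneOn_exp_quadratic {η : ℝ} (hη : 0 < η) :
    MonotoneOn (fun s => Real.exp (s / 4 + η * s ^ 2 / 2)) (Ici 0) := fun s hs t _ hst => by
  have hs : 0 ≤ s := hs
  dsimp only
  gcongr

/-- Second order Taylor approximation of Airy pairs in the small parameter. -/
theorem IsAiryPair.abs_sub_taylor_le {η : ℝ} (hη : 0 < η) {u v : ℝ → ℝ} (h : IsAiryPair η u v)
    {s : ℝ} (hs : 0 ≤ s) :
    |u s - (u 0 + v 0 * s) - η * (u 0 * s ^ 3 / 6 + v 0 * s ^ 4 / 12)| ≤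
      η ^ 2 * (|u 0| + 2 * |v 0|) * s ^ 6 * Real.exp (s / 4 + η * s ^ 2 / 2) ∧
    |v s - v 0 - η * (u 0 * s ^ 2 / 2 + v 0 * s ^ 3 / 3)| ≤
      η ^ 2 * (|u 0| + 2 * |v 0|) * s ^ 5 * Real.exp (s / 4 + η * s ^ 2 / 2) := by
  set g : ℝ → ℝ := fun s => Real.exp (s / 4 + η * s ^ 2 / 2) with hg
  have hmono : MonotoneOn g (Ici 0) := monotoneOn_exp_quadratic hη
  have hg0 : ∀ s, 0 ≤ g s := fun s => (Real.exp_pos _).le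
  set C := |u 0| + 2 * |v 0| with hC
  have hC0 : 0 ≤ C := by positivity
  have hu : ∀ s, 0 ≤ s → |u s| ≤ C * g s := fun s hs => by
    refine abs_le_of_sq_le_sq ?_ (mul_nonneg hC0 (hg0 s))
    -- With `k = 1/2`, `|u|` grows at most like `exp (s / 4 + η s² / 2)`: the quadratic part exactly
    -- cancels that of the weight, and `exp (s / 4)` is beaten by `exp (-b s)` because `b > 1/4`.
    have e := h.energy_le_of_nonneg (k := 1 / 2) (by norm_num) hs
    have e2 : Real.exp (1 / 2 * s + |η| * s ^ 2 / (2 * (1 / 2))) = g s ^ 2 := by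
      rw [hg, ← Real.exp_nat_mul, abs_of_pos hη]
      congr 1
      push_cast
      ring
    have e3 : u 0 ^ 2 + 4 * v 0 ^ 2 ≤ C ^ 2 := by
      rw [hC, ← sq_abs (u 0), ← sq_abs (v 0)]
      nlinarith [mul_nonneg (abs_nonneg (u 0)) (abs_nonneg (v 0))]
    have e4 := mul_le_mul_of_nonneg_right e3 (sq_nonneg (g s))
    rw [e2] at e
    rw [mul_pow]
    linarith [sq_nonneg (v s)]
  have hpow : ∀ (n : ℕ) (s : ℝ), HasDerivAt (fun s : ℝ => s ^ (n + 1) / (n + 1 : ℕ)) (s ^ n) s :=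
    fun n s => by
      refine ((hasDerivAt_pow (n + 1) s).div_const _).congr_deriv ?_
      rw [Nat.add_sub_cancel]
      field_simp
  have b1 : ∀ s, 0 ≤ s → |v s - v 0| ≤ η * C * s ^ 2 * g s := fun s hs =>
    abs_le_of_abs_deriv_le (n := 1) (f := fun s => v s - v 0) (f' := fun s => η * s * u s)
      (fun s => (h.deriv_snd s).sub_const _) (sub_self _) (by positivity) hmono hg0
      (fun s hs => by
        rw [abs_mul, abs_of_nonneg (by positivity)]
        refine (mul_le_mul_of_nonneg_left (hu s hs) (by positivity)).trans_eq ?_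
        ring) hs
  have b2 : ∀ s, 0 ≤ s → |u s - (u 0 + v 0 * s)| ≤ η * C * s ^ 3 * g s := fun s hs =>
    abs_le_of_abs_deriv_le (n := 2) (f := fun s => u s - (u 0 + v 0 * s)) (f' := fun s => v s - v 0)
      (fun s => (h.deriv_fst s).sub
        (by simpa using ((hasDerivAt_id s).const_mul (v 0)).const_add (u 0))) (by simp)
      (by positivity) hmono hg0 b1 hs
  have b3 : ∀ s, 0 ≤ s → |v s - v 0 - η * (u 0 * s ^ 2 / 2 + v 0 * s ^ 3 / 3)| ≤
      η ^ 2 * C * s ^ 5 * g s := fun s hs =>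
    abs_le_of_abs_deriv_le (n := 4)
      (f := fun s => v s - v 0 - η * (u 0 * s ^ 2 / 2 + v 0 * s ^ 3 / 3))
      (f' := fun s => η * s * (u s - (u 0 + v 0 * s)))
      (fun s => by
        refine (((h.deriv_snd s).sub_const (v 0)).sub ((((hpow 1 s).const_mul (u 0)).add
          ((hpow 2 s).const_mul (v 0))).const_mul η)).congr_of_eventuallyEq
          (Eventually.of_forall fun s => ?_) |>.congr_deriv ?_
        · simp only [Pi.sub_apply, Pi.add_apply]
          push_cast
          ring
        · ring) (by simp)
      (by positivity) hmono hg0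
      (fun s hs => by
        rw [abs_mul, abs_of_nonneg (by positivity)]
        refine (mul_le_mul_of_nonneg_left (b2 s hs) (by positivity)).trans_eq ?_
        ring) hs
  refine ⟨abs_le_of_abs_deriv_le (n := 5)
      (f := fun s => u s - (u 0 + v 0 * s) - η * (u 0 * s ^ 3 / 6 + v 0 * s ^ 4 / 12))
      (f' := fun s => v s - v 0 - η * (u 0 * s ^ 2 / 2 + v 0 * s ^ 3 / 3))
      (fun s => by
        refine (((h.deriv_fst s).sub (((hasDerivAt_id s).const_mul (v 0)).const_add (u 0))).sub
          ((((hpow 2 s).const_mul (u 0 / 2)).add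
          ((hpow 3 s).const_mul (v 0 / 3))).const_mul η)).congr_of_eventuallyEq
          (Eventually.of_forall fun s => ?_) |>.congr_deriv ?_
        · simp only [Pi.sub_apply, Pi.add_apply, id]
          push_cast
          ring
        · ring) (by simp)
      (by positivity) hmono hg0 b3 hs, b3 s hs⟩

/-- Rests on `1 - V ≤ exp (-V) ≤ 1 - V + V²` for `V ≥ 0`. The remainder keeps `S` beside `exp (-V)`
so that the Gaussian growth of `S` can cancel. -/
theorem abs_exp_neg_mul_sub_le {η V w p q M S : ℝ} (hV : 0 ≤ V)
    (hw : |w - p - η * q| ≤ M * S) :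
    |Real.exp (-V) * w - (p + η * q - V * p)| ≤
      M * (S * Real.exp (-V)) + |η * q| * V + |p| * V ^ 2 := by
  have h1 : 1 - V ≤ Real.exp (-V) := by linarith [Real.add_one_le_exp (-V)]
  have h2 : Real.exp (-V) ≤ 1 - V + V ^ 2 := by
    have h3 : 1 + V ≤ Real.exp V := by linarith [Real.add_one_le_exp V]
    rw [Real.exp_neg, inv_le_iff_one_le_mul₀ (Real.exp_pos V)]
    have h4 := mul_le_mul_of_nonneg_left h3 (show 0 ≤ 1 - V + V ^ 2 by nlinarith [sq_nonneg (V - 1)])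
    nlinarith [pow_nonneg hV 3]
  have h0 : Real.exp (-V) ≤ 1 := Real.exp_le_one_iff.2 (by linarith)
  have e : Real.exp (-V) * w - (p + η * q - V * p) = Real.exp (-V) * (w - p - η * q) +
      (Real.exp (-V) - 1) * (η * q) + (Real.exp (-V) - 1 + V) * p := by ring
  rw [e]
  refine (abs_add_three _ _ _).trans ?_
  rw [abs_mul (Real.exp _), abs_mul (Real.exp _ - 1), abs_mul (Real.exp _ - 1 + V),
    abs_of_pos (Real.exp_pos _)]
  have h5 : |Real.exp (-V) - 1| ≤ V := abs_le.2 ⟨by linarith, by linarith⟩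
  have h6 : |Real.exp (-V) - 1 + V| ≤ V ^ 2 := abs_le.2 ⟨by nlinarith, by linarith⟩
  have k1 := mul_le_mul_of_nonneg_left hw (Real.exp_pos (-V)).le
  have k2 := mul_le_mul_of_nonneg_right h5 (abs_nonneg (η * q))
  have k3 := mul_le_mul_of_nonneg_right h6 (abs_nonneg p)
  linarith

/-! ### Laplace expansion of the integral over `(0, ∞)` -/

theorem integral_pow_mul_exp_neg {b : ℝ} (hb : 0 < b) (n : ℕ) :
    ∫ s in Ioi (0 : ℝ), s ^ n * Real.exp (-(b * s)) = n.factorial / b ^ (n + 1) := by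
  have h := Real.integral_rpow_mul_exp_neg_mul_Ioi (a := n + 1) (by positivity) hb
  rw [Real.Gamma_nat_eq_factorial, add_sub_cancel_right] at h
  simp only [Real.rpow_natCast] at h
  rw [h, ← Nat.cast_succ, Real.rpow_natCast, one_div, inv_pow]
  field_simp

theorem integrableOn_pow_mul_exp_neg {b : ℝ} (hb : 0 < b) (n : ℕ) :
    IntegrableOn (fun s : ℝ => s ^ n * Real.exp (-(b * s))) (Ioi 0) := by
  refine Integrable.of_integral_ne_zero ?_
  rw [integral_pow_mul_exp_neg hb]
  positivity

theorem integrableOn_sum_pow_mul_exp_neg {b : ℝ} (hb : 0 < b) {N : ℕ} (k : Fin N → ℝ) :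
    IntegrableOn (fun s : ℝ => (∑ i, k i * s ^ (i : ℕ)) * Real.exp (-(b * s))) (Ioi 0) := by
  simp_rw [Finset.sum_mul, mul_assoc]
  exact integrable_finsetSum _ fun i _ => (integrableOn_pow_mul_exp_neg hb i).const_mul _

theorem integral_sum_pow_mul_exp_neg {b : ℝ} (hb : 0 < b) {N : ℕ} (k : Fin N → ℝ) :
    ∫ s in Ioi (0 : ℝ), (∑ i, k i * s ^ (i : ℕ)) * Real.exp (-(b * s)) =
      ∑ i, k i * ((i : ℕ).factorial / b ^ ((i : ℕ) + 1)) := by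
  simp_rw [Finset.sum_mul, mul_assoc]
  have hi : ∀ i ∈ Finset.univ, Integrable (fun s : ℝ => k i * (s ^ (i : ℕ) * Real.exp (-(b * s))))
      (volume.restrict (Ioi 0)) := fun i _ => (integrableOn_pow_mul_exp_neg hb i).const_mul _
  rw [integral_finsetSum _ hi]
  simp_rw [integral_const_mul, integral_pow_mul_exp_neg hb]

/-- The first two terms of the Laplace expansion of the forcing integral over `(0, ∞)`. -/
noncomputable def laplaceExpansion (b a d c₁ c₂ η : ℝ) : ℝ :=
  (c₂ * a - c₁ * d) / b + c₂ * d / b ^ 2 +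
    η * (-(c₁ * a + c₂ * a - c₁ * d) / b ^ 3 + (c₂ * a - 2 * c₁ * d - 3 * c₂ * d) / b ^ 4 +
      2 * c₂ * d / b ^ 5)

theorem integral_forcing_taylor {b : ℝ} (hb : 0 < b) (a d c₁ c₂ η : ℝ) :
    IntegrableOn (fun s => (c₂ * (a + d * s) - c₁ * d +
        η * (c₂ * (a * s ^ 3 / 6 + d * s ^ 4 / 12) - c₁ * (a * s ^ 2 / 2 + d * s ^ 3 / 3)) -
        η * s ^ 2 / 2 * (c₂ * (a + d * s) - c₁ * d)) * Real.exp (-(b * s))) (Ioi 0) ∧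
    ∫ s in Ioi (0 : ℝ), (c₂ * (a + d * s) - c₁ * d +
        η * (c₂ * (a * s ^ 3 / 6 + d * s ^ 4 / 12) - c₁ * (a * s ^ 2 / 2 + d * s ^ 3 / 3)) -
        η * s ^ 2 / 2 * (c₂ * (a + d * s) - c₁ * d)) * Real.exp (-(b * s)) =
      laplaceExpansion b a d c₁ c₂ η := by
  set k : Fin 5 → ℝ := ![c₂ * a - c₁ * d, c₂ * d, -η * (c₁ * a + c₂ * a - c₁ * d) / 2,
    η * (c₂ * a / 6 - c₁ * d / 3 - c₂ * d / 2), η * (c₂ * d / 12)] with hk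
  have e : ∀ s : ℝ, c₂ * (a + d * s) - c₁ * d +
      η * (c₂ * (a * s ^ 3 / 6 + d * s ^ 4 / 12) - c₁ * (a * s ^ 2 / 2 + d * s ^ 3 / 3)) -
      η * s ^ 2 / 2 * (c₂ * (a + d * s) - c₁ * d) = ∑ i, k i * s ^ (i : ℕ) := fun s => by
    rw [Fin.sum_univ_five, hk]
    simp
    ring
  simp_rw [e]
  refine ⟨integrableOn_sum_pow_mul_exp_neg hb k, ?_⟩
  rw [integral_sum_pow_mul_exp_neg hb k, Fin.sum_univ_five, hk, laplaceExpansion]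
  simp [Nat.factorial]
  field_simp
  ring

theorem exists_abs_integral_Ioi_sub_le {b : ℝ} (hb : 1 / 4 < b) (a d c₁ c₂ : ℝ) :
    ∃ K, ∀ η, 0 < η → ∀ u v, IsAiryPair η u v → u 0 = a → v 0 = d →
      |(∫ s in Ioi 0, gaussWeight b η s * (c₂ * u s - c₁ * v s)) -
        laplaceExpansion b a d c₁ c₂ η| ≤ K * η ^ 2 := by
  have hb0 : 0 < b := by linarith
  set p : ℝ → ℝ := fun s => c₂ * (a + d * s) - c₁ * d with hp
  set q : ℝ → ℝ := fun s =>
    c₂ * (a * s ^ 3 / 6 + d * s ^ 4 / 12) - c₁ * (a * s ^ 2 / 2 + d * s ^ 3 / 3) with hq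
  set C : ℝ := |a| + 2 * |d| with hC
  -- A majorant independent of `η`; the integrand minus its expansion is at most `η² H`.
  set H : ℝ → ℝ := fun s =>
    C * (|c₂| * (s ^ 6 * Real.exp (-((b - 1 / 4) * s))) +
      |c₁| * (s ^ 5 * Real.exp (-((b - 1 / 4) * s)))) +
    |q s * s ^ 2 / 2 * Real.exp (-(b * s))| + |p s * s ^ 4 / 4 * Real.exp (-(b * s))| with hH
  have hHi : IntegrableOn H (Ioi 0) := by
    have i0 := fun n => integrableOn_pow_mul_exp_neg (b := b - 1 / 4) (by linarith) n
    have i1 := fun n => integrableOn_pow_mul_exp_neg hb0 n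
    have iq : IntegrableOn (fun s => q s * s ^ 2 / 2 * Real.exp (-(b * s))) (Ioi 0) := by
      refine (((i1 4).const_mul (-(c₁ * a / 4))).add (((i1 5).const_mul
        (c₂ * a / 12 - c₁ * d / 6)).add ((i1 6).const_mul (c₂ * d / 24)))).congr
        (ae_of_all _ fun s => ?_)
      simp only [hq, Pi.add_apply]
      ring
    have ip : IntegrableOn (fun s => p s * s ^ 4 / 4 * Real.exp (-(b * s))) (Ioi 0) := by
      refine (((i1 4).const_mul ((c₂ * a - c₁ * d) / 4)).add
        ((i1 5).const_mul (c₂ * d / 4))).congr (ae_of_all _ fun s => ?_)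
      simp only [hp, Pi.add_apply]
      ring
    exact (((((i0 6).const_mul |c₂|).add ((i0 5).const_mul |c₁|)).const_mul C).add iq.abs).add
      ip.abs
  refine ⟨∫ s in Ioi 0, H s, fun η hη u v h hu hv => ?_⟩
  obtain ⟨iT, eT⟩ := integral_forcing_taylor hb0 a d c₁ c₂ η
  rw [← eT, ← integral_sub ((h.subgaussian_forcing c₁ c₂).integrable b hη).integrableOn iT,
    mul_comm _ (η ^ 2), ← integral_const_mul]
  refine (norm_integral_le_integral_norm _).trans
    (setIntegral_mono_on (((h.subgaussian_forcing c₁ c₂).integrable b hη).integrableOn.sub iT).norm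
      (hHi.const_mul _) measurableSet_Ioi fun s hs => ?_)
  have hs : 0 ≤ s := (mem_Ioi.1 hs).le
  obtain ⟨t1, t2⟩ := h.abs_sub_taylor_le hη hs
  rw [hu, hv, ← hC] at t1 t2
  have t3 : |(c₂ * u s - c₁ * v s) - p s - η * q s| ≤
      η ^ 2 * (C * (|c₂| * s ^ 6 + |c₁| * s ^ 5)) * Real.exp (s / 4 + η * s ^ 2 / 2) := by
    have e : (c₂ * u s - c₁ * v s) - p s - η * q s =
        c₂ * (u s - (a + d * s) - η * (a * s ^ 3 / 6 + d * s ^ 4 / 12)) -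
        c₁ * (v s - d - η * (a * s ^ 2 / 2 + d * s ^ 3 / 3)) := by
      simp only [hp, hq]
      ring
    rw [e]
    refine (abs_sub _ _).trans ?_
    rw [abs_mul, abs_mul]
    have k1 := mul_le_mul_of_nonneg_left t1 (abs_nonneg c₂)
    have k2 := mul_le_mul_of_nonneg_left t2 (abs_nonneg c₁)
    linarith
  have t4 := abs_exp_neg_mul_sub_le (V := η * s ^ 2 / 2) (by positivity) t3
  have e1 : Real.exp (s / 4 + η * s ^ 2 / 2) * Real.exp (-(η * s ^ 2 / 2)) = Real.exp (s / 4) := by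
    rw [← Real.exp_add]
    congr 1
    ring
  have e2 : gaussWeight b η s = Real.exp (-(b * s)) * Real.exp (-(η * s ^ 2 / 2)) := by
    rw [gaussWeight, ← Real.exp_add]
    congr 1
  have e3 : Real.exp (-((b - 1 / 4) * s)) = Real.exp (-(b * s)) * Real.exp (s / 4) := by
    rw [← Real.exp_add]
    congr 1
    ring
  rw [e1] at t4
  have e4 : Real.exp (-(b * s)) * Real.exp (-(η * s ^ 2 / 2)) * (c₂ * u s - c₁ * v s) -
      (p s + η * q s - η * s ^ 2 / 2 * p s) * Real.exp (-(b * s)) = Real.exp (-(b * s)) *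
      (Real.exp (-(η * s ^ 2 / 2)) * (c₂ * u s - c₁ * v s) -
        (p s + η * q s - η * s ^ 2 / 2 * p s)) := by ring
  change |gaussWeight b η s * (c₂ * u s - c₁ * v s) -
      (p s + η * q s - η * s ^ 2 / 2 * p s) * Real.exp (-(b * s))| ≤ _
  rw [e2, e4, abs_mul, abs_of_pos (Real.exp_pos _)]
  refine (mul_le_mul_of_nonneg_left t4 (Real.exp_pos _).le).trans_eq ?_
  simp only [hH, e3]
  rw [abs_mul, abs_mul, abs_mul, abs_div, abs_div, abs_mul, abs_mul, abs_of_pos hη,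
    abs_of_pos (Real.exp_pos _), abs_of_nonneg (pow_nonneg hs 2), abs_of_nonneg (pow_nonneg hs 4),
    abs_of_pos (two_pos (α := ℝ)), abs_of_pos (four_pos (α := ℝ))]
  ring

/-! ### The value at `t = b` and return to the original time -/

theorem exists_abs_value_sub_le {b : ℝ} (hb₁ : 1 / 4 < b) (hb₂ : b < 1 / 2 + √3 / 6)
    (a d c₁ c₂ : ℝ) :
    ∃ K, ∀ η, 0 < η → η ≤ b - 1 / 4 → ∀ x y, IsFastSolution b c₁ c₂ η x y →
      Tendsto x atBot (𝓝 0) → Tendsto y atBot (𝓝 0) →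
      |y 0 * a - x 0 * d + η * laplaceExpansion b a d c₁ c₂ η| ≤ K * η ^ 3 := by
  obtain ⟨K₁, hK₁⟩ := exists_abs_integral_gaussWeight_le hb₁ hb₂ a d c₁ c₂
  obtain ⟨K₂, hK₂⟩ := exists_abs_integral_Ioi_sub_le hb₁ a d c₁ c₂
  refine ⟨K₁ + K₂, fun η hη hηb x y hX hx hy => ?_⟩
  obtain ⟨u, v, h, hu, hv⟩ := exists_isAiryPair η a d
  have e1 := hX.representation hη hx hy h 0
  have e2 : gaussWeight b η 0 = 1 := by simp [gaussWeight]
  have hi := (h.subgaussian_forcing c₁ c₂).integrable b hη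
  have e3 := intervalIntegral.integral_Iic_add_Ioi (b := 0) hi.integrableOn hi.integrableOn
  rw [e2, one_mul, hu, hv, forcingIntegral] at e1
  have b1 := hK₁ η hη hηb u v h hu hv
  have b2 := hK₂ η hη u v h hu hv
  rw [← e3] at b1
  set I := ∫ s in Iic 0, gaussWeight b η s * (c₂ * u s - c₁ * v s)
  set J := ∫ s in Ioi 0, gaussWeight b η s * (c₂ * u s - c₁ * v s)
  have e4 : y 0 * a - x 0 * d + η * laplaceExpansion b a d c₁ c₂ η =
      η * ((I + J) - (J - laplaceExpansion b a d c₁ c₂ η)) := by rw [e1]; ring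
  rw [e4, abs_mul, abs_of_pos hη]
  calc _ ≤ η * (K₁ * η ^ 2 + K₂ * η ^ 2) := by
        refine mul_le_mul_of_nonneg_left ((abs_sub _ _).trans (add_le_add b1 b2)) hη.le
    _ = _ := by ring

theorem IsDistinguishedMinus.isFastSolution {b c₁ c₂ ε : ℝ} (hε : 0 < ε) {X : ℝ → ℝ × ℝ}
    (h : IsDistinguishedMinus b c₁ c₂ ε X) :
    IsFastSolution b c₁ c₂ (ε ^ 3) (fun s => (X (b + ε ^ 3 * s)).1)
        (fun s => (X (b + ε ^ 3 * s)).2) ∧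
      Tendsto (fun s => (X (b + ε ^ 3 * s)).1) atBot (𝓝 0) ∧
      Tendsto (fun s => (X (b + ε ^ 3 * s)).2) atBot (𝓝 0) := by
  have hη : 0 < ε ^ 3 := by positivity
  have ht : ∀ s : ℝ, HasDerivAt (fun s : ℝ => b + ε ^ 3 * s) (ε ^ 3) s := fun s => by
    simpa using ((hasDerivAt_id s).const_mul (ε ^ 3)).const_add b
  have hlim := h.2.comp (tendsto_affine_atBot b hη)
  refine ⟨⟨fun s => ?_, fun s => ?_⟩, (continuous_fst.tendsto _).comp hlim,
    (continuous_snd.tendsto _).comp hlim⟩ <;>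
    obtain ⟨x', y', hx, hy, ex, ey⟩ := h.1 (b + ε ^ 3 * s)
  · refine (hx.comp s (ht s)).congr_deriv ?_
    linear_combination ex
  · refine (hy.comp s (ht s)).congr_deriv ?_
    linear_combination ey

theorem existsUnique_isDistinguishedMinus (b c₁ c₂ : ℝ) {ε : ℝ} (hε : 0 < ε) :
    ∃! X : ℝ → ℝ × ℝ, IsDistinguishedMinus b c₁ c₂ ε X := by
  have hη : 0 < ε ^ 3 := by positivity
  refine existsUnique_of_exists_of_unique ?_ fun X X' h h' => ?_
  · obtain ⟨x, y, hX, hx, hy⟩ := IsFastSolution.exists b c₁ c₂ hη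
    have ht : ∀ t : ℝ, HasDerivAt (fun t : ℝ => (t - b) / ε ^ 3) (1 / ε ^ 3) t := fun t =>
      ((hasDerivAt_id t).sub_const b).div_const _
    have hlim : Tendsto (fun t : ℝ => (t - b) / ε ^ 3) atBot atBot :=
      (tendsto_atBot_add_const_right _ (-b) tendsto_id).atBot_div_const hη
    refine ⟨fun t => (x ((t - b) / ε ^ 3), y ((t - b) / ε ^ 3)), fun t =>
      ⟨_, _, (hX.deriv_fst _).comp t (ht t), (hX.deriv_snd _).comp t (ht t), ?_, ?_⟩,
      (hx.comp hlim).prodMk_nhds (hy.comp hlim)⟩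
    · field_simp
      ring
    · field_simp
      ring
  · obtain ⟨hX, hx, hy⟩ := h.isFastSolution hε
    obtain ⟨hX', hx', hy'⟩ := h'.isFastSolution hε
    funext t
    have := hX.unique hη hx hy hX' hx' hy' ((t - b) / ε ^ 3)
    have e : b + ε ^ 3 * ((t - b) / ε ^ 3) = t := by
      field_simp
      ring
    rw [e] at this
    exact Prod.ext this.1 this.2

theorem isBigO_value_at_fold {b : ℝ} (hb₁ : 1 / 4 < b) (hb₂ : b < 1 / 2 + √3 / 6)
    (a d c₁ c₂ : ℝ) {X : ℝ → ℝ → ℝ × ℝ}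
    (hX : ∀ ε : ℝ, 0 < ε → IsDistinguishedMinus b c₁ c₂ ε (X ε)) :
    (fun ε : ℝ => (X ε b).2 * a - (X ε b).1 * d +
      ε ^ 3 * laplaceExpansion b a d c₁ c₂ (ε ^ 3)) =O[𝓝[>] 0] (fun ε : ℝ => ε ^ 9) := by
  obtain ⟨K, hK⟩ := exists_abs_value_sub_le hb₁ hb₂ a d c₁ c₂
  refine IsBigO.of_bound K ?_
  have hcont : Tendsto (fun ε : ℝ => ε ^ 3) (𝓝[>] 0) (𝓝 0) := by
    have : Tendsto (fun ε : ℝ => ε ^ 3) (𝓝 0) (𝓝 (0 ^ 3)) := (continuous_pow 3).tendsto 0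
    rw [zero_pow three_ne_zero] at this
    exact this.mono_left nhdsWithin_le_nhds
  filter_upwards [self_mem_nhdsWithin, hcont.eventually (ge_mem_nhds (sub_pos.2 hb₁))] with ε hε hεb
  have hε : 0 < ε := hε
  obtain ⟨hF, hx, hy⟩ := (hX ε hε).isFastSolution hε
  have := hK (ε ^ 3) (by positivity) hεb _ _ hF hx hy
  simp only [mul_zero, add_zero] at this
  rw [Real.norm_eq_abs, Real.norm_eq_abs, abs_of_pos (by positivity : 0 < ε ^ 9)]
  exact this.trans_eq (by ring)

theorem proposition15 (b c₁ c₂ : ℝ) (hb₁ : 1 / 4 < b) (hb₂ : b < 1 / 2 + √3 / 6) :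
    (∀ ε : ℝ, 0 < ε → ∃! X : ℝ → ℝ × ℝ, IsDistinguishedMinus b c₁ c₂ ε X) ∧
    ∀ X : ℝ → ℝ → ℝ × ℝ, (∀ ε : ℝ, 0 < ε → IsDistinguishedMinus b c₁ c₂ ε (X ε)) →
      (fun ε : ℝ => (X ε b).1 -
          ((-(1 / b) * c₁ + 1 / b ^ 2 * c₂) * ε ^ 3 +
            ((1 / b ^ 3 - 2 / b ^ 4) * c₁ + (-(3 / b ^ 4) + 2 / b ^ 5) * c₂) * ε ^ 6))
        =O[𝓝[>] 0] (fun ε : ℝ => ε ^ 9) ∧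
      (fun ε : ℝ => (X ε b).2 -
          (-(1 / b) * c₂ * ε ^ 3 +
            (1 / b ^ 3 * c₁ + (1 / b ^ 3 - 1 / b ^ 4) * c₂) * ε ^ 6))
        =O[𝓝[>] 0] (fun ε : ℝ => ε ^ 9) := by
  refine ⟨fun ε hε => existsUnique_isDistinguishedMinus b c₁ c₂ hε, fun X hX => ⟨?_, ?_⟩⟩
  -- The Airy data `(u 0, v 0) = (0, -1)` make `y u - x v` equal to `x` at `s = 0`; the data `(1,
  -- 0)` below give `y`.
  · refine (isBigO_value_at_fold hb₁ hb₂ 0 (-1) c₁ c₂ hX).congr_left fun ε => ?_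
    rw [laplaceExpansion]
    ring
  · refine (isBigO_value_at_fold hb₁ hb₂ 1 0 c₁ c₂ hX).congr_left fun ε => ?_
    rw [laplaceExpansion]
    ring
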